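/- Let $X\in\mathbb R^{n\times p}$, $y\in\mathbb R^n$, $D\in\mathbb R^{m\times p}$, $C\in\mathbb R^{q\times p}$, $d\in\mathbb R^q$, $E\in\mathbb R^{s\times p}$, $f\in\mathbb R^s$, $0<\tau<1$, $\gamma>0$, and let $\rho_\tau(r)=\sum_{i=1}^n\big(\tau r_i\mathbf 1(r_i>0)-(1-\tau)r_i\mathbf 1(r_i\le 0)\big)$. Let $p_\lambda:\mathbb R^m\to\mathbb R$ be a convex penalty. Suppose that $\mathcal C=\{\beta: C\beta\ge d,\ E\beta=f\}$ is nonempty. Consider the reformulated problem $$\min_{\beta,r,z,w}\ \rho_\tau(r)+p_\lambda(z)+\phi(w)\quad\text{subject to}\quad y-X\beta=r,\ D\beta=z,\ C\beta-w=d,\ E\beta=f,\tag{P}$$ where $\phi(w)=0$ if $w\ge0$ componentwise and $\phi(w)=\infty$ otherwise. Suppose that $p_\lambda$ is symmetric, $p_\lambda(-z)=p_\lambda(z)$, or, if it is not, that (P) has a solution. Each LCG-QR ADMM algorithm is the direct multi-block ADMM with scaled dual variable $u$ and parameter $\gamma$ for a reformulation of $\min\{\rho_\tau(y-X\beta)+p_\lambda(D\beta):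 C\beta\ge d,\ E\beta=f\}$: in each iteration the augmented Lagrangian (objective plus $\frac\gamma2\|A_1\beta+A_2r+\cdots-c+u\|_2^2$, where $A_1\beta+A_2r+\cdots=c$ is the constraint system) is minimized over the blocks one after the other in the listed order, each time with the newest values of the other blocks and without the summands that do not involve the block, and then $u$ is increased by the residual $A_1\beta+A_2r+\cdots-c$. The four algorithms are: * ADMM4.Constr: problem (P), blocks $\beta,r,z,w$. * ADMM4.Proj: $\min\rho_\tau(r)+p_\lambda(z)+\phi_{\mathcal C}(w)$ subject to $y-X\beta=r$, $D\beta=z$, $\beta=w$, blocks $\beta,r,z,w$. * ADMM3.Constr: $\min\rho_\tau(r)+p_\lambda(D\beta)+\phi(w)$ subject to $y-X\beta=r$, $C\beta-w=d$, $E\beta=f$, blocks $\beta,r,w$. * ADMM3.Proj: $\min\rho_\tau(r)+p_\lambda(D\beta)+\phi_{\mathcal C}(w)$ subject to $y-X\beta=r$, $\beta=w$, blocks $\beta,r,w$. Here $\phi_{\mathcal C}$ is $0$ on $\mathcal C$ and $\infty$ elsewhere. For ADMM4.Constr assume that $X^TX+D^TD+C^TC+E^TE$ is invertible, and for ADMM3.Constr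 that $X^TX+C^TC+E^TE$ is invertible. Then for each of the four algorithms and from every starting point the iterations can be carried out (all minimizers exist), and for every resulting sequence the iterates $\beta^k$ converge to a point $\beta^*$ that solves (P), that is, $\beta^*$ is the $\beta$-block of a solution $(\beta^*,r^*,z^*,w^*)$ of (P). For ADMM4.Constr, moreover, $(\beta^k,r^k,z^k,w^k)\to(\beta^*,r^*,z^*,w^*)$. -/

import Mathlib

open Filter Topology

/-- Data of a linearly constrained quantile regression with a generalized penalty:
minimize `ρ_τ (y - X β) + pen (D β)` subject to `C β ≥ d`, `E β = f`.
Here `pen` is the penalty `p_λ` at the (fixed) tuning parameter `λ`. -/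
structure LCGQR (n m p q s : ℕ) where
  X : Matrix (Fin n) (Fin p) ℝ
  y : Fin n → ℝ
  D : Matrix (Fin m) (Fin p) ℝ
  C : Matrix (Fin q) (Fin p) ℝ
  d : Fin q → ℝ
  E : Matrix (Fin s) (Fin p) ℝ
  f : Fin s → ℝ
  tau : ℝ
  pen : (Fin m → ℝ) → ℝ

namespace LCGQR

/-- The scalar check loss `τ t 1(t > 0) - (1 - τ) t 1(t ≤ 0)`. -/
noncomputable def checkLoss (tau t : ℝ) : ℝ :=
  if 0 < t then tau * t else -((1 - tau) * t)

/-- The squared Euclidean norm. -/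
def sqNorm {k : ℕ} (v : Fin k → ℝ) : ℝ := ∑ i, v i ^ 2

open Classical in
/-- The extended-real indicator function of a set: `0` on the set, `∞` off it. -/
noncomputable def indicatorTop {α : Type*} (S : Set α) (x : α) : EReal :=
  if x ∈ S then 0 else ⊤

/-- The componentwise nonnegative vectors. -/
def nonnegVec (q : ℕ) : Set (Fin q → ℝ) := {w | ∀ i, 0 ≤ w i}

variable {n m p q s : ℕ}

/-- The loss `ρ_τ` of a residual vector. -/
noncomputable def rho (P : LCGQR n m p q s) (r : Fin n → ℝ) : ℝ :=
  ∑ i, checkLoss P.tau (r i)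

/-- The polyhedron `{β | C β ≥ d, E β = f}`. -/
def feasibleSet (P : LCGQR n m p q s) : Set (Fin p → ℝ) :=
  {b | (∀ i, P.d i ≤ (P.C.mulVec b) i) ∧ P.E.mulVec b = P.f}

/-! ### The reformulated problem in the blocks `β, r, z, w` -/

/-- The linear constraints `y - X β = r`, `D β = z`, `C β - w = d`, `E β = f`. -/
def LinConstr (P : LCGQR n m p q s) (b : Fin p → ℝ) (r : Fin n → ℝ) (z : Fin m → ℝ)
    (w : Fin q → ℝ) : Prop :=
  P.y - P.X.mulVec b = r ∧ P.D.mulVec b = z ∧ P.C.mulVec b - w = P.d ∧ P.E.mulVec b = P.f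

/-- The objective `ρ_τ(r) + p_λ(z) + φ(w)`, with `φ` the indicator of `w ≥ 0`. -/
noncomputable def objective (P : LCGQR n m p q s) (r : Fin n → ℝ) (z : Fin m → ℝ)
    (w : Fin q → ℝ) : EReal :=
  ((P.rho r + P.pen z : ℝ) : EReal) + indicatorTop (nonnegVec q) w

/-- `(β, r, z, w)` solves the reformulated problem. -/
def IsSolution (P : LCGQR n m p q s) (b : Fin p → ℝ) (r : Fin n → ℝ) (z : Fin m → ℝ)
    (w : Fin q → ℝ) : Prop :=
  P.LinConstr b r z w ∧
    ∀ b' r' z' w', P.LinConstr b' r' z' w' → P.objective r z w ≤ P.objective r' z' w'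

/-! ### The four algorithms

In each of them a step minimizes the augmented Lagrangian over one block after the other, always
with the newest values of the other blocks, and then updates the scaled dual variable.  In the
minimization over a block the summands of the Lagrangian that do not involve it are dropped. -/

/-- Iterate of ADMM4.Constr: primal blocks and scaled dual variable `u = (u₁, u₂, u₃, u₄)`. -/
structure Constr4State (n m p q s : ℕ) where
  beta : Fin p → ℝ
  r : Fin n → ℝ
  z : Fin m → ℝ
  w : Fin q → ℝ
  u₁ : Fin n → ℝ
  u₂ : Fin m → ℝ
  u₃ : Fin q → ℝ
  u₄ : Fin s → ℝ

/-- The quadratic term `‖A₁ β + A₂ r + A₃ z + A₄ w - c + u‖²` of ADMM4.Constr. -/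
def quad4Constr (P : LCGQR n m p q s) (b : Fin p → ℝ) (r : Fin n → ℝ) (z : Fin m → ℝ)
    (w : Fin q → ℝ) (u₁ : Fin n → ℝ) (u₂ : Fin m → ℝ) (u₃ : Fin q → ℝ) (u₄ : Fin s → ℝ) : ℝ :=
  sqNorm (P.X.mulVec b + r - P.y + u₁) + sqNorm (P.D.mulVec b - z + u₂) +
    sqNorm (P.C.mulVec b - w - P.d + u₃) + sqNorm (P.E.mulVec b - P.f + u₄)

/-- One step of ADMM4.Constr with parameter `γ`, from `a` to `a'`. -/
structure Constr4Step (P : LCGQR n m p q s) (γ : ℝ) (a a' : Constr4State n m p q s) : Prop where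
  beta_min : IsMinOn
    (fun b => γ / 2 * P.quad4Constr b a.r a.z a.w a.u₁ a.u₂ a.u₃ a.u₄) Set.univ a'.beta
  r_min : IsMinOn
    (fun r => P.rho r + γ / 2 * P.quad4Constr a'.beta r a.z a.w a.u₁ a.u₂ a.u₃ a.u₄)
    Set.univ a'.r
  z_min : IsMinOn
    (fun z => P.pen z + γ / 2 * P.quad4Constr a'.beta a'.r z a.w a.u₁ a.u₂ a.u₃ a.u₄)
    Set.univ a'.z
  w_min : IsMinOn
    (fun w => indicatorTop (nonnegVec q) w +
      ((γ / 2 * P.quad4Constr a'.beta a'.r a'.z w a.u₁ a.u₂ a.u₃ a.u₄ : ℝ) : EReal))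
    Set.univ a'.w
  u₁_eq : a'.u₁ = a.u₁ + (P.X.mulVec a'.beta + a'.r - P.y)
  u₂_eq : a'.u₂ = a.u₂ + (P.D.mulVec a'.beta - a'.z)
  u₃_eq : a'.u₃ = a.u₃ + (P.C.mulVec a'.beta - a'.w - P.d)
  u₄_eq : a'.u₄ = a.u₄ + (P.E.mulVec a'.beta - P.f)

/-- Iterate of ADMM4.Proj (here `w` is a copy of `β`). -/
structure Proj4State (n m p : ℕ) where
  beta : Fin p → ℝ
  r : Fin n → ℝ
  z : Fin m → ℝ
  w : Fin p → ℝ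
  u₁ : Fin n → ℝ
  u₂ : Fin m → ℝ
  u₃ : Fin p → ℝ

/-- The quadratic term of ADMM4.Proj, for the constraints `y - X β = r`, `D β = z`, `β = w`. -/
def quad4Proj (P : LCGQR n m p q s) (b : Fin p → ℝ) (r : Fin n → ℝ) (z : Fin m → ℝ)
    (w : Fin p → ℝ) (u₁ : Fin n → ℝ) (u₂ : Fin m → ℝ) (u₃ : Fin p → ℝ) : ℝ :=
  sqNorm (P.X.mulVec b + r - P.y + u₁) + sqNorm (P.D.mulVec b - z + u₂) + sqNorm (b - w + u₃)

/-- One step of ADMM4.Proj with parameter `γ`, from `a` to `a'`. -/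
structure Proj4Step (P : LCGQR n m p q s) (γ : ℝ) (a a' : Proj4State n m p) : Prop where
  beta_min : IsMinOn
    (fun b => γ / 2 * P.quad4Proj b a.r a.z a.w a.u₁ a.u₂ a.u₃) Set.univ a'.beta
  r_min : IsMinOn
    (fun r => P.rho r + γ / 2 * P.quad4Proj a'.beta r a.z a.w a.u₁ a.u₂ a.u₃) Set.univ a'.r
  z_min : IsMinOn
    (fun z => P.pen z + γ / 2 * P.quad4Proj a'.beta a'.r z a.w a.u₁ a.u₂ a.u₃) Set.univ a'.z
  w_min : IsMinOn
    (fun w => indicatorTop P.feasibleSet w +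
      ((γ / 2 * P.quad4Proj a'.beta a'.r a'.z w a.u₁ a.u₂ a.u₃ : ℝ) : EReal))
    Set.univ a'.w
  u₁_eq : a'.u₁ = a.u₁ + (P.X.mulVec a'.beta + a'.r - P.y)
  u₂_eq : a'.u₂ = a.u₂ + (P.D.mulVec a'.beta - a'.z)
  u₃_eq : a'.u₃ = a.u₃ + (a'.beta - a'.w)

/-- Iterate of ADMM3.Constr. -/
structure Constr3State (n p q s : ℕ) where
  beta : Fin p → ℝ
  r : Fin n → ℝ
  w : Fin q → ℝ
  u₁ : Fin n → ℝ
  u₂ : Fin q → ℝ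
  u₃ : Fin s → ℝ

/-- The quadratic term of ADMM3.Constr, for `y - X β = r`, `C β - w = d`, `E β = f`. -/
def quad3Constr (P : LCGQR n m p q s) (b : Fin p → ℝ) (r : Fin n → ℝ) (w : Fin q → ℝ)
    (u₁ : Fin n → ℝ) (u₂ : Fin q → ℝ) (u₃ : Fin s → ℝ) : ℝ :=
  sqNorm (P.X.mulVec b + r - P.y + u₁) + sqNorm (P.C.mulVec b - w - P.d + u₂) +
    sqNorm (P.E.mulVec b - P.f + u₃)

/-- One step of ADMM3.Constr with parameter `γ`, from `a` to `a'`. -/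
structure Constr3Step (P : LCGQR n m p q s) (γ : ℝ) (a a' : Constr3State n p q s) : Prop where
  beta_min : IsMinOn
    (fun b => P.pen (P.D.mulVec b) + γ / 2 * P.quad3Constr b a.r a.w a.u₁ a.u₂ a.u₃)
    Set.univ a'.beta
  r_min : IsMinOn
    (fun r => P.rho r + γ / 2 * P.quad3Constr a'.beta r a.w a.u₁ a.u₂ a.u₃) Set.univ a'.r
  w_min : IsMinOn
    (fun w => indicatorTop (nonnegVec q) w +
      ((γ / 2 * P.quad3Constr a'.beta a'.r w a.u₁ a.u₂ a.u₃ : ℝ) : EReal))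
    Set.univ a'.w
  u₁_eq : a'.u₁ = a.u₁ + (P.X.mulVec a'.beta + a'.r - P.y)
  u₂_eq : a'.u₂ = a.u₂ + (P.C.mulVec a'.beta - a'.w - P.d)
  u₃_eq : a'.u₃ = a.u₃ + (P.E.mulVec a'.beta - P.f)

/-- Iterate of ADMM3.Proj (here `w` is a copy of `β`). -/
structure Proj3State (n p : ℕ) where
  beta : Fin p → ℝ
  r : Fin n → ℝ
  w : Fin p → ℝ
  u₁ : Fin n → ℝ
  u₂ : Fin p → ℝ

/-- The quadratic term of ADMM3.Proj, for the constraints `y - X β = r`, `β = w`. -/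
def quad3Proj (P : LCGQR n m p q s) (b : Fin p → ℝ) (r : Fin n → ℝ) (w : Fin p → ℝ)
    (u₁ : Fin n → ℝ) (u₂ : Fin p → ℝ) : ℝ :=
  sqNorm (P.X.mulVec b + r - P.y + u₁) + sqNorm (b - w + u₂)

/-- One step of ADMM3.Proj with parameter `γ`, from `a` to `a'`. -/
structure Proj3Step (P : LCGQR n m p q s) (γ : ℝ) (a a' : Proj3State n p) : Prop where
  beta_min : IsMinOn
    (fun b => P.pen (P.D.mulVec b) + γ / 2 * P.quad3Proj b a.r a.w a.u₁ a.u₂) Set.univ a'.beta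
  r_min : IsMinOn
    (fun r => P.rho r + γ / 2 * P.quad3Proj a'.beta r a.w a.u₁ a.u₂) Set.univ a'.r
  w_min : IsMinOn
    (fun w => indicatorTop P.feasibleSet w +
      ((γ / 2 * P.quad3Proj a'.beta a'.r w a.u₁ a.u₂ : ℝ) : EReal))
    Set.univ a'.w
  u₁_eq : a'.u₁ = a.u₁ + (P.X.mulVec a'.beta + a'.r - P.y)
  u₂_eq : a'.u₂ = a.u₂ + (a'.beta - a'.w)

/-- An infinite run of an algorithm given by its step relation. -/
def IsRun {α : Type*} (step : α → α → Prop) (a : ℕ → α) : Prop :=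
  ∀ k, step (a k) (a (k + 1))

end LCGQR

/-!
All four algorithms are two-block methods in disguise. Once `β` is fixed, the quadratic term is a
sum in which the blocks `r`, `z`, `w` are separated, so minimizing over them one after the other is
minimizing over the single block `v = (y - r, z, w + d, f)` (or `(y - r, z, w)`, and so on). With
this block the constraints read `A β = v`, `v ∈ K`, where `A` stacks the matrices involved and is
injective: by hypothesis for the `Constr` variants, because of the identity block for the `Proj`
variants.

For `min F β + G v` subject to `A β = v`, `v ∈ K`, let `(β*, v*, u*)` be a saddle point. The
optimality conditions of the steps, written as variational inequalities, show that
`‖v - v*‖² + ‖u - u*‖²` decreases by at least the squared length of each step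
(`IsADMMSeq.lyapunov`). Hence the iterates are bounded and successive differences vanish, a cluster
point satisfies the saddle point inequalities, and the distance to this particular saddle point,
being monotone and zero along a subsequence, tends to zero (`IsADMMSeq.tendsto`). Convergence of `β`
follows from injectivity of `A`.

A saddle point exists as soon as the problem has a solution (`exists_isSaddlePoint`). Hahn-Banach
separation of the strict epigraph of `F β + G v` from the graph of `A` gives subgradients
(`exists_subgradients_of_min`), and Farkas' lemma (`exists_nonneg_vecMul_eq`) turns the remaining
inward normal of the polyhedron into multipliers of its constraints; no Slater point is needed.

A solution exists if the penalty is symmetric, because then a direction in which the objective is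
nonincreasing can be reversed (`LCGQR.cost_sub_le_of_symm`), and a convex function with this
property attains its minimum on every nonempty polyhedron (`exists_isMinOn_polyhedron`). Farkas'
lemma comes from the same attainment result, applied to the distance of a vector to the cone.
-/

section

open scoped Matrix

/-! ### Regularized minimization: existence and first-order condition -/

section Proximal

variable {ι κ : Type*} [Fintype ι] [Fintype κ]

theorem dotProduct_self_nonneg_real (v : ι → ℝ) : 0 ≤ v ⬝ᵥ v :=
  Finset.sum_nonneg fun i _ => mul_self_nonneg (v i)

theorem sq_apply_le_dotProduct_self (v : ι → ℝ) (i : ι) : v i ^ 2 ≤ v ⬝ᵥ v := by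
  rw [pow_two]
  exact Finset.single_le_sum (f := fun j => v j * v j) (fun j _ => mul_self_nonneg (v j))
    (Finset.mem_univ i)

theorem sq_norm_le_dotProduct_self (v : ι → ℝ) : ‖v‖ ^ 2 ≤ v ⬝ᵥ v := by
  have h : ‖v‖ ≤ √(v ⬝ᵥ v) := by
    rw [pi_norm_le_iff_of_nonneg (Real.sqrt_nonneg _)]
    intro i
    rw [Real.norm_eq_abs]
    exact Real.abs_le_sqrt (sq_apply_le_dotProduct_self v i)
  calc ‖v‖ ^ 2 ≤ √(v ⬝ᵥ v) ^ 2 := by gcongr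
    _ = v ⬝ᵥ v := Real.sq_sqrt (dotProduct_self_nonneg_real v)

theorem tendsto_of_dotProduct_self_sub {v : ℕ → ι → ℝ} {l : ι → ℝ}
    (h : Tendsto (fun k => (v k - l) ⬝ᵥ (v k - l)) atTop (𝓝 0)) : Tendsto v atTop (𝓝 l) := by
  rw [tendsto_iff_norm_sub_tendsto_zero]
  have h2 : Tendsto (fun k => ‖v k - l‖ ^ 2) atTop (𝓝 0) :=
    squeeze_zero (fun k => by positivity) (fun k => sq_norm_le_dotProduct_self _) h
  have h3 := h2.sqrt
  simpa [Real.sqrt_sq] using h3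

theorem Filter.Tendsto.dotProduct_real {α : Type*} {l : Filter α} {f g : α → ι → ℝ} {a b : ι → ℝ}
    (hf : Tendsto f l (𝓝 a)) (hg : Tendsto g l (𝓝 b)) :
    Tendsto (fun t => f t ⬝ᵥ g t) l (𝓝 (a ⬝ᵥ b)) :=
  tendsto_finsetSum _ fun i _ => (tendsto_pi_nhds.1 hf i).mul (tendsto_pi_nhds.1 hg i)

theorem continuous_of_convexOn_univ {f : (ι → ℝ) → ℝ} (hf : ConvexOn ℝ Set.univ f) :
    Continuous f :=
  continuousOn_univ.1 (hf.continuousOn isOpen_univ)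

/-- A finite convex function decreases at most linearly at infinity. -/
theorem exists_linear_lower_bound {f : (ι → ℝ) → ℝ} (hf : ConvexOn ℝ Set.univ f) :
    ∃ c, 0 ≤ c ∧ ∀ x, -(c * (1 + ‖x‖)) ≤ f x := by
  obtain ⟨M, hM⟩ := (isCompact_closedBall (0 : ι → ℝ) 1).bddAbove_image
    (continuous_of_convexOn_univ hf).continuousOn
  refine ⟨|f 0| + |f 0 - M|, by positivity, fun x => ?_⟩
  have ht : 0 ≤ ‖x‖ := norm_nonneg x
  obtain ⟨e, he, hx⟩ : ∃ e : ι → ℝ, ‖e‖ ≤ 1 ∧ x + ‖x‖ • e = 0 := by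
    rcases eq_or_ne x 0 with rfl | hx
    · exact ⟨0, by simp, by simp⟩
    · have h0 : ‖x‖ ≠ 0 := norm_ne_zero_iff.2 hx
      refine ⟨-(‖x‖⁻¹ • x), ?_, ?_⟩
      · rw [norm_neg, norm_smul, norm_inv, norm_norm, inv_mul_cancel₀ h0]
      · rw [smul_neg, smul_smul, mul_inv_cancel₀ h0, one_smul, add_neg_cancel]
  have hp : 0 < 1 + ‖x‖ := by linarith
  have h1 := hf.2 (Set.mem_univ x) (Set.mem_univ e) (show 0 ≤ (1 + ‖x‖)⁻¹ by positivity)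
    (show 0 ≤ (1 + ‖x‖)⁻¹ * ‖x‖ by positivity) (by field_simp)
  have h2 : (1 + ‖x‖)⁻¹ • x + ((1 + ‖x‖)⁻¹ * ‖x‖) • e = 0 := by
    rw [mul_smul, ← smul_add, hx, smul_zero]
  rw [h2, smul_eq_mul, smul_eq_mul] at h1
  have h3 : (1 + ‖x‖) * f 0 ≤ f x + ‖x‖ * f e := by
    have := mul_le_mul_of_nonneg_left h1 hp.le
    have e1 : (1 + ‖x‖) * ((1 + ‖x‖)⁻¹ * f x + (1 + ‖x‖)⁻¹ * ‖x‖ * f e)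
        = f x + ‖x‖ * f e := by field_simp
    linarith
  have h4 : f e ≤ M := hM ⟨e, by simpa using he, rfl⟩
  have h5 : ‖x‖ * f e ≤ ‖x‖ * M := by gcongr
  have h6 : ‖x‖ * -|f 0 - M| ≤ ‖x‖ * (f 0 - M) := by
    gcongr; exact neg_abs_le _
  have h7 := neg_abs_le (f 0)
  nlinarith [abs_nonneg (f 0 - M), mul_nonneg ht (abs_nonneg (f 0))]

/-- Adding the square of an injective affine map makes a convex function attain its minimum on
every nonempty closed set. -/
theorem exists_min_add_sq {f : (ι → ℝ) → ℝ} (hf : ConvexOn ℝ Set.univ f) {S : Set (ι → ℝ)}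
    (hS : IsClosed S) (hne : S.Nonempty) {L : (ι → ℝ) →ₗ[ℝ] (κ → ℝ)}
    (hL : Function.Injective L) (b : κ → ℝ) {γ : ℝ} (hγ : 0 < γ) :
    ∃ x ∈ S, IsMinOn (fun x => f x + γ / 2 * ((L x + b) ⬝ᵥ (L x + b))) S x := by
  obtain ⟨x₀, hx₀⟩ := hne
  have hLc : Continuous L := L.continuous_of_finiteDimensional
  have hc : Continuous (fun x => f x + γ / 2 * ((L x + b) ⬝ᵥ (L x + b))) :=
    (continuous_of_convexOn_univ hf).add
      (continuous_const.mul ((hLc.add continuous_const).dotProduct (hLc.add continuous_const)))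
  obtain ⟨c, hc0, hlow⟩ := exists_linear_lower_bound hf
  obtain ⟨K, hK0, hK⟩ := L.exists_antilipschitzWith (LinearMap.ker_eq_bot.2 hL)
  have hK0' : (0 : ℝ) < K := hK0
  -- `s² ≥ 2 R s - R²` turns the square into a linear bound whose slope is chosen to beat `c`.
  have hcoer : ∃ B, ∀ x, ‖x‖ - B ≤ f x + γ / 2 * ((L x + b) ⬝ᵥ (L x + b)) := by
    set R : ℝ := K * (c + 1) / γ with hR
    have hR0 : 0 ≤ R := by positivity
    refine ⟨c + γ * R * ‖b‖ + γ / 2 * R ^ 2, fun x => ?_⟩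
    have h1 : ‖x‖ ≤ K * ‖L x‖ := by
      simpa using hK.le_mul_dist x 0
    have h2 : ‖L x‖ ≤ ‖L x + b‖ + ‖b‖ := by
      simpa using norm_sub_le (L x + b) b
    have h3 := sq_norm_le_dotProduct_self (L x + b)
    have h4 : 2 * R * ‖L x + b‖ - R ^ 2 ≤ ‖L x + b‖ ^ 2 := by
      nlinarith [sq_nonneg (‖L x + b‖ - R)]
    have h5 : γ / 2 * (2 * R * (‖L x‖ - ‖b‖) - R ^ 2)
        ≤ γ / 2 * ((L x + b) ⬝ᵥ (L x + b)) := by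
      gcongr
      nlinarith
    have h6 : γ * R * ‖L x‖ = (c + 1) * (K * ‖L x‖) := by
      rw [hR]; field_simp
    have h7 : (c + 1) * ‖x‖ ≤ (c + 1) * (K * ‖L x‖) := by gcongr
    have := hlow x
    nlinarith
  obtain ⟨B, hB⟩ := hcoer
  refine hc.continuousOn.exists_isMinOn' hS hx₀ ?_
  refine Filter.Eventually.filter_mono inf_le_left ?_
  filter_upwards [(tendsto_norm_cocompact_atTop (E := ι → ℝ)).eventually_ge_atTop
    (f x₀ + γ / 2 * ((L x₀ + b) ⬝ᵥ (L x₀ + b)) + B)] with x hx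
  have := hB x
  linarith

end Proximal

theorem nonneg_of_forall_add_mul_nonneg {a c : ℝ} (h : ∀ t, 0 < t → t ≤ 1 → 0 ≤ a + t * c) :
    0 ≤ a := by
  have ht : Tendsto (fun t : ℝ => a + t * c) (𝓝[>] 0) (𝓝 (a + 0 * c)) :=
    ((continuous_const.add (continuous_id.mul continuous_const)).tendsto 0).mono_left
      nhdsWithin_le_nhds
  rw [zero_mul, add_zero] at ht
  refine ge_of_tendsto ht ?_
  filter_upwards [Ioc_mem_nhdsGT (zero_lt_one' ℝ)] with t ht using h t ht.1 ht.2

/-- First-order condition at a minimizer of a convex function plus the square of an affine map: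
the square may be replaced by its derivative. -/
theorem IsMinOn.variational_ineq {ι κ : Type*} [Fintype κ] {f : (ι → ℝ) → ℝ}
    {S : Set (ι → ℝ)} (hf : ConvexOn ℝ S f) {L : (ι → ℝ) →ₗ[ℝ] (κ → ℝ)} {b : κ → ℝ} {γ : ℝ}
    {z : ι → ℝ} (hz : IsMinOn (fun x => f x + γ / 2 * ((L x + b) ⬝ᵥ (L x + b))) S z) (hzS : z ∈ S)
    {x : ι → ℝ} (hx : x ∈ S) :
    0 ≤ f x - f z + γ * ((L z + b) ⬝ᵥ L (x - z)) := by
  refine nonneg_of_forall_add_mul_nonneg (c := γ / 2 * (L (x - z) ⬝ᵥ L (x - z)))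
    fun t ht ht1 => ?_
  have h1 := hf.2 hzS hx (sub_nonneg.2 ht1) ht.le (by ring)
  have hmem := hf.1 hzS hx (sub_nonneg.2 ht1) ht.le (by ring)
  have h2 := isMinOn_iff.1 hz _ hmem
  have h3 : L ((1 - t) • z + t • x) + b = (L z + b) + t • L (x - z) := by
    rw [map_add, map_smul, map_smul, map_sub]
    module
  rw [h3] at h2
  simp only [add_dotProduct, dotProduct_add, smul_dotProduct, dotProduct_smul,
    smul_eq_mul] at h1 h2 ⊢
  rw [dotProduct_comm (L (x - z)) (L z), dotProduct_comm (L (x - z)) b] at h2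
  refine nonneg_of_mul_nonneg_right (a := t) ?_ ht
  nlinarith

/-! ### Attainment of minima on polyhedra -/

theorem convexOn_sq_affine {ι κ : Type*} [Fintype κ] (L : (ι → ℝ) →ₗ[ℝ] (κ → ℝ)) (b : κ → ℝ) :
    ConvexOn ℝ Set.univ fun x => (L x + b) ⬝ᵥ (L x + b) := by
  refine ⟨convex_univ, fun x _ x' _ s t hs ht hst => ?_⟩
  have h1 : L (s • x + t • x') + b = s • (L x + b) + t • (L x' + b) := by
    rw [map_add, map_smul, map_smul, smul_add, smul_add]
    nth_rewrite 1 [← one_smul ℝ b]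
    rw [← hst]
    module
  have h2 := mul_nonneg (mul_nonneg hs ht)
    (dotProduct_self_nonneg_real ((L x + b) - (L x' + b)))
  simp only [h1]
  generalize L x + b = p at *
  generalize L x' + b = r at *
  obtain rfl : s = 1 - t := by linarith
  simp only [add_dotProduct, dotProduct_add, smul_dotProduct, dotProduct_smul, sub_dotProduct,
    dotProduct_sub, smul_eq_mul, dotProduct_comm r p] at h2 ⊢
  nlinarith

section Polyhedron

variable {ι κ J : Type*} [Fintype ι] [Fintype κ] [Fintype J]

/-- If a convex function stays bounded along an unbounded sequence, then it is nonincreasing along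
every limit direction of that sequence. -/
theorem nonincreasing_of_limit_direction {Ψ : (ι → ℝ) → ℝ} (hΨ : ConvexOn ℝ Set.univ Ψ)
    {y : ℕ → ι → ℝ} {M : ℝ} (hM : ∀ k, Ψ (y k) ≤ M)
    (hy : Tendsto (fun k => ‖y k‖) atTop atTop) {h : ι → ℝ}
    (hh : Tendsto (fun k => ‖y k‖⁻¹ • y k) atTop (𝓝 h)) {t : ℝ} (ht : 0 ≤ t) (x : ι → ℝ) :
    Ψ (x + t • h) ≤ Ψ x := by
  have hinv : Tendsto (fun k => t * ‖y k‖⁻¹) atTop (𝓝 0) := by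
    simpa using hy.inv_tendsto_atTop.const_mul t
  have hpt : Tendsto (fun k => (1 - t * ‖y k‖⁻¹) • x + t • (‖y k‖⁻¹ • y k)) atTop
      (𝓝 (x + t • h)) := by
    have := ((tendsto_const_nhds (x := (1 : ℝ))).sub hinv).smul_const x |>.add (hh.const_smul t)
    simpa using this
  have hval : Tendsto (fun k => (1 - t * ‖y k‖⁻¹) * Ψ x + t * ‖y k‖⁻¹ * M) atTop (𝓝 (Ψ x)) := by
    have := ((tendsto_const_nhds (x := (1 : ℝ))).sub hinv).mul_const (Ψ x) |>.add
      (hinv.mul_const M)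
    simpa using this
  refine le_of_tendsto_of_tendsto
    (((continuous_of_convexOn_univ hΨ).tendsto _).comp hpt) hval ?_
  filter_upwards [hinv.eventually_le_const zero_lt_one] with k hk
  have h0 : 0 ≤ t * ‖y k‖⁻¹ := by positivity
  have h1 := hΨ.2 (Set.mem_univ x) (Set.mem_univ (y k)) (sub_nonneg.2 hk) h0 (by ring)
  have h2 : t * ‖y k‖⁻¹ * Ψ (y k) ≤ t * ‖y k‖⁻¹ * M := by
    gcongr
    exact hM k
  simp only [smul_eq_mul, mul_smul] at h1
  simp only [Function.comp_apply]
  linarith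

/-- Far out in the direction `h`, a polyhedron that contains a sequence going to infinity in this
direction also contains the sequence moved back by `h`. -/
theorem eventually_sub_mem_polyhedron {C : Matrix J ι ℝ} {d : J → ℝ} {y : ℕ → ι → ℝ}
    (hy : Tendsto (fun k => ‖y k‖) atTop atTop) {h : ι → ℝ}
    (hh : Tendsto (fun k => ‖y k‖⁻¹ • y k) atTop (𝓝 h)) (hQ : ∀ k, d ≤ C *ᵥ y k) :
    ∀ᶠ k in atTop, d ≤ C *ᵥ (y k - h) := by
  simp only [Pi.le_def]
  rw [eventually_all]
  intro i
  have hlim : Tendsto (fun k => ‖y k‖⁻¹ * (C *ᵥ y k) i) atTop (𝓝 ((C *ᵥ h) i)) := by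
    have hc : Continuous fun x : ι → ℝ => (C *ᵥ x) i :=
      (continuous_apply i).comp (continuous_const.matrix_mulVec continuous_id)
    refine ((hc.tendsto h).comp hh).congr fun k => ?_
    simp [Matrix.mulVec_smul]
  have hnn : 0 ≤ (C *ᵥ h) i := by
    have h0 : Tendsto (fun k => ‖y k‖⁻¹ * d i) atTop (𝓝 0) := by
      simpa using hy.inv_tendsto_atTop.mul_const (d i)
    refine le_of_tendsto_of_tendsto' h0 hlim fun k => ?_
    have := hQ k i
    gcongr
  rcases hnn.eq_or_lt with h0 | h0
  · filter_upwards with k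
    rw [Matrix.mulVec_sub, Pi.sub_apply, ← h0, sub_zero]
    exact hQ k i
  · have hinf : Tendsto (fun k => ‖y k‖ * (‖y k‖⁻¹ * (C *ᵥ y k) i)) atTop atTop :=
      hy.atTop_mul_pos h0 hlim
    filter_upwards [hinf.eventually_ge_atTop (d i + (C *ᵥ h) i), hy.eventually_gt_atTop 0]
      with k hk hk0
    rw [mul_inv_cancel_left₀ hk0.ne'] at hk
    rw [Matrix.mulVec_sub, Pi.sub_apply]
    linarith

/-- A convex function attains its minimum on a nonempty polyhedron if every direction in which it
is nonincreasing can be reversed.  The points of the polyhedron that minimize the function plus a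
vanishing multiple of the squared norm stay bounded: otherwise moving such a point back along a
limit direction would shorten it without increasing the function. -/
theorem exists_isMinOn_polyhedron {Ψ : (ι → ℝ) → ℝ} (hΨ : ConvexOn ℝ Set.univ Ψ)
    (C : Matrix J ι ℝ) (d : J → ℝ) (hne : ∃ x, d ≤ C *ᵥ x)
    (hrev : ∀ h, (∀ t : ℝ, 0 ≤ t → ∀ x, Ψ (x + t • h) ≤ Ψ x) → ∀ x, Ψ (x - h) ≤ Ψ x) :
    ∃ x, d ≤ C *ᵥ x ∧ ∀ x', d ≤ C *ᵥ x' → Ψ x ≤ Ψ x' := by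
  have hΨc := continuous_of_convexOn_univ hΨ
  have hclosed : IsClosed {x | d ≤ C *ᵥ x} :=
    isClosed_le continuous_const (continuous_const.matrix_mulVec continuous_id)
  obtain ⟨x₀, hx₀⟩ := hne
  have hε : ∀ k : ℕ, (0 : ℝ) < 1 / (k + 1) := fun k => by positivity
  have hex : ∀ k : ℕ, ∃ x, d ≤ C *ᵥ x ∧ ∀ x', d ≤ C *ᵥ x' →
      Ψ x + 1 / ((k : ℝ) + 1) * (x ⬝ᵥ x) ≤ Ψ x' + 1 / ((k : ℝ) + 1) * (x' ⬝ᵥ x') := by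
    intro k
    obtain ⟨x, hx, hmin⟩ := exists_min_add_sq hΨ hclosed ⟨x₀, hx₀⟩
      (L := LinearMap.id) Function.injective_id 0 (γ := 2 * (1 / ((k : ℝ) + 1)))
      (mul_pos two_pos (hε k))
    refine ⟨x, hx, fun x' hx' => ?_⟩
    simpa [mul_div_assoc] using isMinOn_iff.1 hmin x' hx'
  choose x hxQ hxmin using hex
  have hbdd : ∀ k, Ψ (x k) ≤ Ψ x₀ + x₀ ⬝ᵥ x₀ := fun k => by
    have h1 := hxmin k x₀ hx₀
    have h2 : 1 / ((k : ℝ) + 1) ≤ 1 := by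
      rw [div_le_one (by positivity)]
      linarith [Nat.cast_nonneg (α := ℝ) k]
    have h3 : 0 ≤ 1 / ((k : ℝ) + 1) * (x k ⬝ᵥ x k) :=
      mul_nonneg (hε k).le (dotProduct_self_nonneg_real _)
    have h4 : 1 / ((k : ℝ) + 1) * (x₀ ⬝ᵥ x₀) ≤ 1 * (x₀ ⬝ᵥ x₀) := by
      have := dotProduct_self_nonneg_real x₀
      gcongr
    linarith
  by_cases hinf : Tendsto (fun k => ‖x k‖) atTop atTop
  · exfalso
    obtain ⟨h, -, φ, hφ, hh⟩ := tendsto_subseq_of_bounded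
      (Metric.isBounded_closedBall (x := (0 : ι → ℝ)) (r := 1))
      (x := fun k => ‖x k‖⁻¹ • x k) (fun k => by
        rw [mem_closedBall_zero_iff, norm_smul, norm_inv, norm_norm]
        exact inv_mul_le_one)
    have hy : Tendsto (fun k => ‖x (φ k)‖) atTop atTop := hinf.comp hφ.tendsto_atTop
    have hh' : Tendsto (fun k => ‖x (φ k)‖⁻¹ • x (φ k)) atTop (𝓝 h) := hh
    have hdown := hrev h fun t ht z =>
      nonincreasing_of_limit_direction hΨ (fun k => hbdd (φ k)) hy hh' ht z
    have hnorm : ‖h‖ = 1 := by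
      refine tendsto_nhds_unique hh'.norm (tendsto_const_nhds.congr' ?_)
      filter_upwards [hy.eventually_gt_atTop 0] with k hk
      rw [norm_smul, norm_inv, norm_norm, inv_mul_cancel₀ hk.ne']
    have hpos : 0 < h ⬝ᵥ h := by
      have := sq_norm_le_dotProduct_self h
      rw [hnorm] at this
      linarith
    have hdot : Tendsto (fun k => ‖x (φ k)‖ * ((‖x (φ k)‖⁻¹ • x (φ k)) ⬝ᵥ h)) atTop atTop := by
      refine hy.atTop_mul_pos hpos ?_
      exact ((continuous_id.dotProduct continuous_const).tendsto h).comp hh'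
    obtain ⟨k, hk1, hk2, hk3⟩ := ((eventually_sub_mem_polyhedron hy hh' fun k => hxQ (φ k)).and
      ((hdot.eventually_gt_atTop (h ⬝ᵥ h)).and (hy.eventually_gt_atTop 0))).exists
    rw [smul_dotProduct, smul_eq_mul, mul_inv_cancel_left₀ hk3.ne'] at hk2
    have h1 := hxmin (φ k) _ hk1
    have h2 := hdown (x (φ k))
    have h3 : (x (φ k) - h) ⬝ᵥ (x (φ k) - h)
        = x (φ k) ⬝ᵥ x (φ k) - 2 * (x (φ k) ⬝ᵥ h) + h ⬝ᵥ h := by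
      rw [sub_dotProduct, dotProduct_sub, dotProduct_sub, dotProduct_comm h (x (φ k))]
      ring
    rw [h3] at h1
    have h4 : 0 < 1 / ((φ k : ℝ) + 1) * (2 * (x (φ k) ⬝ᵥ h) - h ⬝ᵥ h) :=
      mul_pos (hε _) (by linarith)
    nlinarith
  · have hfreq : ∃ R, ∃ᶠ k in atTop, x k ∈ Metric.closedBall (0 : ι → ℝ) R := by
      rw [tendsto_atTop] at hinf
      push Not at hinf
      obtain ⟨R, hR⟩ := hinf
      refine ⟨R, hR.mono fun k hk => ?_⟩
      rw [mem_closedBall_zero_iff]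
      exact hk.le
    obtain ⟨R, hR⟩ := hfreq
    obtain ⟨z, -, φ, hφ, hz⟩ := tendsto_subseq_of_frequently_bounded
      Metric.isBounded_closedBall hR
    refine ⟨z, hclosed.mem_of_tendsto hz (Eventually.of_forall fun k => hxQ (φ k)),
      fun x' hx' => ?_⟩
    have hlim : Tendsto (fun k => Ψ x' + 1 / ((φ k : ℝ) + 1) * (x' ⬝ᵥ x')) atTop
        (𝓝 (Ψ x')) := by
      have := ((tendsto_one_div_add_atTop_nhds_zero_nat (𝕜 := ℝ)).comp
        hφ.tendsto_atTop).mul_const (x' ⬝ᵥ x') |>.const_add (Ψ x')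
      simpa using this
    refine le_of_tendsto_of_tendsto' ((hΨc.tendsto z).comp hz) hlim fun k => ?_
    have h1 := hxmin (φ k) x' hx'
    have h3 : 0 ≤ 1 / ((φ k : ℝ) + 1) * (x (φ k) ⬝ᵥ x (φ k)) :=
      mul_nonneg (hε _).le (dotProduct_self_nonneg_real _)
    simp only [Function.comp_apply]
    linarith

/-! ### Multipliers for linear constraints -/

/-- **Farkas' lemma**: a vector that has a nonnegative product with every vector `e` such that
`0 ≤ C e` is a nonnegative combination of the rows of `C`. The combination is the one closest to
the vector. -/
theorem exists_nonneg_vecMul_eq (C : Matrix J ι ℝ) (g : ι → ℝ)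
    (hg : ∀ e, 0 ≤ C *ᵥ e → 0 ≤ g ⬝ᵥ e) : ∃ l : J → ℝ, 0 ≤ l ∧ l ᵥ* C = g := by
  classical
  set L : (J → ℝ) →ₗ[ℝ] (ι → ℝ) := C.vecMulLinear with hL
  obtain ⟨l, hl, hmin⟩ := exists_isMinOn_polyhedron (convexOn_sq_affine L (-g))
    (1 : Matrix J J ℝ) 0 ⟨0, by simp⟩ (by
      intro h hh x
      have hz : L h = 0 := by
        refine dotProduct_self_eq_zero.1 (le_antisymm ?_ (dotProduct_self_nonneg_real _))
        by_contra! hpos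
        -- at `t`, the quadratic `t ↦ ‖L (t h) - g‖²` already exceeds its value at `0`
        have ht := hh (2 * |L h ⬝ᵥ g| / (L h ⬝ᵥ L h) + 1) (by positivity) 0
        set t := 2 * |L h ⬝ᵥ g| / (L h ⬝ᵥ L h) + 1 with htdef
        have ht1 : t * (L h ⬝ᵥ L h) = 2 * |L h ⬝ᵥ g| + L h ⬝ᵥ L h := by
          rw [htdef]; field_simp
        have ht0 : 0 < t := by positivity
        simp only [map_smul, map_zero, zero_add, add_dotProduct, dotProduct_add,
          smul_dotProduct, dotProduct_smul, smul_eq_mul, neg_dotProduct, dotProduct_neg,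
          dotProduct_comm g (L h)] at ht
        have := le_abs_self (L h ⬝ᵥ g)
        nlinarith
      rw [map_sub, hz, sub_zero])
  simp only [Matrix.one_mulVec] at hl hmin
  refine ⟨l, hl, ?_⟩
  have hvi : ∀ l', 0 ≤ l' → 0 ≤ (L l + -g) ⬝ᵥ L (l' - l) := by
    intro l' hl'
    have hmin' : IsMinOn (fun x => (fun _ => (0 : ℝ)) x + 2 / 2 * ((L x + -g) ⬝ᵥ (L x + -g)))
        (Set.Ici 0) l := isMinOn_iff.2 fun x hx => by simpa using hmin x hx
    have := hmin'.variational_ineq (convexOn_const 0 (convex_Ici 0)) hl hl'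
    simp only [sub_self, zero_add] at this
    linarith
  set e := L l + -g with he
  -- the residual `e` is orthogonal to the projection and makes no obtuse angle with the cone
  have h0 : e ⬝ᵥ L l ≤ 0 := by
    have := hvi 0 le_rfl
    rw [zero_sub, map_neg, dotProduct_neg] at this
    linarith
  have hcone : 0 ≤ C *ᵥ e := by
    intro j
    have := hvi (l + Pi.single j 1) (add_nonneg hl (by simp [Pi.single_nonneg]))
    rw [add_sub_cancel_left] at this
    simpa [hL, Matrix.mulVec, dotProduct_comm, Matrix.row] using this
  have h1 := hg e hcone
  have h2 : e ⬝ᵥ e = e ⬝ᵥ L l - g ⬝ᵥ e := by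
    nth_rewrite 2 [he]
    rw [dotProduct_add, dotProduct_neg, dotProduct_comm g e]
    ring
  have h3 : e = 0 := dotProduct_self_eq_zero.1
    (le_antisymm (by linarith) (dotProduct_self_nonneg_real e))
  have : L l = g := by rw [← sub_eq_zero, sub_eq_add_neg, ← he, h3]
  simpa [hL] using this

/-- The normal cone of a polyhedron is generated by the rows of its active constraints. -/
theorem exists_multiplier_polyhedron (C : Matrix J ι ℝ) (d : J → ℝ) {x₀ : ι → ℝ}
    (hx₀ : d ≤ C *ᵥ x₀) (g : ι → ℝ) (hg : ∀ x, d ≤ C *ᵥ x → 0 ≤ g ⬝ᵥ (x - x₀)) :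
    ∃ l : J → ℝ, 0 ≤ l ∧ l ᵥ* C = g ∧ ∀ j, l j * ((C *ᵥ x₀) j - d j) = 0 := by
  classical
  set C' : Matrix J ι ℝ := fun j => if (C *ᵥ x₀) j = d j then C j else 0 with hC'
  have hact : ∀ j e, (C *ᵥ x₀) j = d j → (C' *ᵥ e) j = (C *ᵥ e) j := fun j e hj => by
    have : C' j = C j := if_pos hj
    rw [Matrix.mulVec, Matrix.mulVec, this]
  obtain ⟨l, hl, hlg⟩ := exists_nonneg_vecMul_eq C' g (by
    intro e he
    -- a direction that the active constraints allow is feasible for a short time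
    have hev : ∀ᶠ t : ℝ in 𝓝[>] 0, d ≤ C *ᵥ (x₀ + t • e) := by
      simp only [Pi.le_def]
      rw [eventually_all]
      intro j
      rcases (hx₀ j).eq_or_lt with hj | hj
      · filter_upwards [self_mem_nhdsWithin] with t ht
        have h1 : 0 ≤ (C *ᵥ e) j := by rw [← hact j e hj.symm]; exact he j
        rw [Matrix.mulVec_add, Matrix.mulVec_smul, Pi.add_apply, Pi.smul_apply, smul_eq_mul, hj]
        have := mul_nonneg (Set.mem_Ioi.1 ht).le h1
        linarith
      · have hc : Continuous fun t : ℝ => (C *ᵥ (x₀ + t • e)) j :=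
          (continuous_apply j).comp (continuous_const.matrix_mulVec
            (continuous_const.add (continuous_id.smul continuous_const)))
        have := hc.tendsto 0
        rw [zero_smul, add_zero] at this
        exact ((this.mono_left nhdsWithin_le_nhds).eventually_const_lt hj).mono fun _ h => h.le
    obtain ⟨t, ht, ht0⟩ := (hev.and self_mem_nhdsWithin).exists
    have := hg _ ht
    rw [add_sub_cancel_left, dotProduct_smul, smul_eq_mul] at this
    exact nonneg_of_mul_nonneg_right this ht0)
  refine ⟨fun j => if (C *ᵥ x₀) j = d j then l j else 0, ?_, ?_, ?_⟩
  · intro j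
    dsimp only
    split_ifs
    exacts [hl j, le_rfl]
  · rw [← hlg]
    ext i
    simp only [Matrix.vecMul, dotProduct, hC']
    refine Finset.sum_congr rfl fun j _ => ?_
    split_ifs <;> simp
  · intro j
    dsimp only
    split_ifs with h
    · rw [h, sub_self, mul_zero]
    · rw [zero_mul]

end Polyhedron

theorem LinearMap.exists_eq_dotProduct {ι : Type*} [Fintype ι] (f : (ι → ℝ) →ₗ[ℝ] ℝ) :
    ∃ a : ι → ℝ, ∀ x, f x = a ⬝ᵥ x := by
  classical
  refine ⟨fun i => f (Pi.single i 1), fun x => ?_⟩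
  rw [LinearMap.pi_apply_eq_sum_univ f x, dotProduct]
  refine Finset.sum_congr rfl fun i _ => ?_
  rw [smul_eq_mul, mul_comm]
  congr 2
  ext j
  simp [Pi.single_apply, eq_comm]

/-- At a minimizer of `F x + G (A x)` over a convex set, with `F` and `G` convex and finite, there
are subgradients of `F` and `G` whose sum is an inward normal of the set: the strict epigraph of
`(x, v) ↦ F x + G v` is separated from the graph of `A`. -/
theorem exists_subgradients_of_min {ι κ : Type*} [Fintype ι] [Fintype κ] {F : (ι → ℝ) → ℝ}
    {G : (κ → ℝ) → ℝ}
    (hF : ConvexOn ℝ Set.univ F) (hG : ConvexOn ℝ Set.univ G) (A : Matrix κ ι ℝ)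
    {S : Set (ι → ℝ)} (hS : Convex ℝ S) {x₀ : ι → ℝ} (hx₀ : x₀ ∈ S)
    (hmin : ∀ x ∈ S, F x₀ + G (A *ᵥ x₀) ≤ F x + G (A *ᵥ x)) :
    ∃ a b, (∀ x, F x₀ + a ⬝ᵥ (x - x₀) ≤ F x) ∧
      (∀ v, G (A *ᵥ x₀) + b ⬝ᵥ (v - A *ᵥ x₀) ≤ G v) ∧
      ∀ x ∈ S, 0 ≤ (a + b ᵥ* A) ⬝ᵥ (x - x₀) := by
  have hFc := continuous_of_convexOn_univ hF
  have hGc := continuous_of_convexOn_univ hG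
  set val := F x₀ + G (A *ᵥ x₀) with hval
  have hconv : Convex ℝ {p : (ι → ℝ) × (κ → ℝ) × ℝ | F p.1 + G p.2.1 < p.2.2 + val} := by
    intro p hp p' hp' s t hs ht hst
    have h1 := hF.2 (Set.mem_univ p.1) (Set.mem_univ p'.1) hs ht hst
    have h2 := hG.2 (Set.mem_univ p.2.1) (Set.mem_univ p'.2.1) hs ht hst
    simp only [Set.mem_ofPred_eq, Prod.fst_add, Prod.smul_fst, Prod.snd_add, Prod.smul_snd,
      smul_eq_mul] at hp hp' h1 h2 ⊢
    obtain rfl : s = 1 - t := by linarith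
    rcases ht.eq_or_lt with rfl | ht
    · nlinarith
    · nlinarith [mul_le_mul_of_nonneg_left hp.le hs, mul_lt_mul_of_pos_left hp' ht]
  have hopen : IsOpen {p : (ι → ℝ) × (κ → ℝ) × ℝ | F p.1 + G p.2.1 < p.2.2 + val} := by
    refine isOpen_lt ?_ ?_ <;> fun_prop
  have hgraph : Convex ℝ ((fun x => (x, A *ᵥ x, (0 : ℝ))) '' S) := by
    have : IsLinearMap ℝ fun x : ι → ℝ => (x, A *ᵥ x, (0 : ℝ)) :=
      ⟨fun x x' => by simp [Matrix.mulVec_add], fun c x => by simp [Matrix.mulVec_smul]⟩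
    exact hS.is_linear_image this
  obtain ⟨f, u, hf1, hf2⟩ := geometric_hahn_banach_open hconv hopen hgraph (by
    rw [Set.disjoint_right]
    rintro _ ⟨x, hx, rfl⟩ h
    have := hmin x hx
    simp only [Set.mem_ofPred_eq, zero_add] at h
    linarith)
  obtain ⟨a, ha⟩ := LinearMap.exists_eq_dotProduct
    (f.toLinearMap ∘ₗ LinearMap.inl ℝ (ι → ℝ) ((κ → ℝ) × ℝ))
  obtain ⟨b, hb⟩ := LinearMap.exists_eq_dotProduct
    (f.toLinearMap ∘ₗ LinearMap.inr ℝ (ι → ℝ) ((κ → ℝ) × ℝ) ∘ₗ LinearMap.inl ℝ (κ → ℝ) ℝ)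
  set c := f (0, 0, 1) with hc
  have hf : ∀ x v t, f (x, v, t) = a ⬝ᵥ x + b ⬝ᵥ v + t * c := by
    intro x v t
    have h1 : (x, v, t) = (x, 0) + (((0 : ι → ℝ), v, (0 : ℝ))
        + t • ((0 : ι → ℝ), (0 : κ → ℝ), (1 : ℝ))) := by
      simp
    rw [h1, map_add, map_add, map_smul, ← hc, smul_eq_mul, ← ha, ← hb]
    simp [add_assoc]
  have hfS : ∀ x ∈ S, u ≤ a ⬝ᵥ x + b ⬝ᵥ (A *ᵥ x) := fun x hx => by
    simpa [hf] using hf2 _ ⟨x, hx, rfl⟩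
  have hepi : ∀ x v t, F x + G v < t + val → a ⬝ᵥ x + b ⬝ᵥ v + t * c < u := fun x v t h => by
    simpa [hf] using hf1 (x, v, t) h
  have hc0 : c < 0 := by
    have h1 := hfS x₀ hx₀
    have h2 := hepi x₀ (A *ᵥ x₀) 1 (by linarith)
    linarith
  have hle : ∀ x v, a ⬝ᵥ x + b ⬝ᵥ v + (F x + G v - val) * c ≤ u := by
    intro x v
    refine le_of_forall_pos_lt_add fun ε hε => ?_
    have := hepi x v (F x + G v - val + ε / (-c)) (by
      have := div_pos hε (neg_pos.2 hc0)
      linarith)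
    have h2 : ε / (-c) * c = -ε := by
      rw [div_neg, neg_mul, div_mul_cancel₀ _ hc0.ne]
    nlinarith
  have hu : u = a ⬝ᵥ x₀ + b ⬝ᵥ (A *ᵥ x₀) := by
    refine le_antisymm (hfS x₀ hx₀) ?_
    have := hle x₀ (A *ᵥ x₀)
    rw [← hval, sub_self, zero_mul, add_zero] at this
    exact this
  have hci : c * (-c)⁻¹ = -1 := by
    rw [inv_neg, mul_neg, mul_inv_cancel₀ hc0.ne]
  have hpos : 0 < (-c)⁻¹ := inv_pos.2 (neg_pos.2 hc0)
  refine ⟨(-c)⁻¹ • a, (-c)⁻¹ • b, fun x => ?_, fun v => ?_, fun x hx => ?_⟩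
  · have h1 := mul_le_mul_of_nonneg_left (hle x (A *ᵥ x₀)) hpos.le
    rw [smul_dotProduct, dotProduct_sub, smul_eq_mul]
    rw [hu] at h1
    linear_combination h1 - (F x + G (A *ᵥ x₀) - val) * hci
  · have h1 := mul_le_mul_of_nonneg_left (hle x₀ v) hpos.le
    rw [smul_dotProduct, dotProduct_sub, smul_eq_mul]
    rw [hu] at h1
    linear_combination h1 - (F x₀ + G v - val) * hci
  · have h1 := hfS x hx
    rw [hu] at h1
    rw [Matrix.smul_vecMul, ← smul_add, smul_dotProduct, smul_eq_mul]
    refine mul_nonneg hpos.le ?_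
    rw [add_dotProduct, dotProduct_sub, dotProduct_sub, ← Matrix.dotProduct_mulVec,
      ← Matrix.dotProduct_mulVec]
    linarith

/-! ### Convergence of the two-block method -/

section ADMM

variable {ι κ : Type*} [Fintype ι] [Fintype κ]

/-- Saddle points of the Lagrangian of `min F x + G v` subject to `A x = v`, `v ∈ K`, by their
variational inequalities. The multiplier of the constraint is `γ u`, that is, `u` is the scaled
dual variable of the alternating direction method with parameter `γ`. -/
structure IsSaddlePoint (F : (ι → ℝ) → ℝ) (G : (κ → ℝ) → ℝ) (K : Set (κ → ℝ))
    (A : Matrix κ ι ℝ) (γ : ℝ) (x : ι → ℝ) (v u : κ → ℝ) : Prop where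
  mem : v ∈ K
  mulVec_eq : A *ᵥ x = v
  left_ineq : ∀ x', 0 ≤ F x' - F x + γ * (u ⬝ᵥ (A *ᵥ (x' - x)))
  right_ineq : ∀ v' ∈ K, 0 ≤ G v' - G v - γ * (u ⬝ᵥ (v' - v))

theorem IsSaddlePoint.isMin {F : (ι → ℝ) → ℝ} {G : (κ → ℝ) → ℝ} {K : Set (κ → ℝ)}
    {A : Matrix κ ι ℝ} {γ : ℝ} {x : ι → ℝ} {v u : κ → ℝ} (h : IsSaddlePoint F G K A γ x v u)
    {x' : ι → ℝ} (hx' : A *ᵥ x' ∈ K) : F x + G (A *ᵥ x) ≤ F x' + G (A *ᵥ x') := by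
  have h1 := h.left_ineq x'
  have h2 := h.right_ineq _ hx'
  rw [Matrix.mulVec_sub, h.mulVec_eq] at h1
  rw [h.mulVec_eq]
  linarith

/-- The iterates of the two-block alternating direction method of multipliers, through the
optimality conditions of their steps: `x (k + 1)` minimizes the augmented Lagrangian in `x`, then
`v (k + 1)` minimizes it over `K`, then `u` is increased by the residual. -/
structure IsADMMSeq (F : (ι → ℝ) → ℝ) (G : (κ → ℝ) → ℝ) (K : Set (κ → ℝ))
    (A : Matrix κ ι ℝ) (γ : ℝ) (x : ℕ → ι → ℝ) (v u : ℕ → κ → ℝ) : Prop where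
  left_ineq : ∀ k x', 0 ≤ F x' - F (x (k + 1))
    + γ * ((A *ᵥ x (k + 1) - v k + u k) ⬝ᵥ (A *ᵥ (x' - x (k + 1))))
  mem : ∀ k, v (k + 1) ∈ K
  right_ineq : ∀ k, ∀ v' ∈ K,
    0 ≤ G v' - G (v (k + 1)) - γ * (u (k + 1) ⬝ᵥ (v' - v (k + 1)))
  dual_eq : ∀ k, u (k + 1) = u k + (A *ᵥ x (k + 1) - v (k + 1))

variable {F : (ι → ℝ) → ℝ} {G : (κ → ℝ) → ℝ} {K : Set (κ → ℝ)} {A : Matrix κ ι ℝ} {γ : ℝ}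
  {x : ℕ → ι → ℝ} {v u : ℕ → κ → ℝ}

/-- The squared distance from the pair `(v, u)` to a saddle point decreases in each step by at
least the squared length of the step. The first step is exempt, as `v 0` need not lie in `K`. -/
theorem IsADMMSeq.lyapunov (hγ : 0 < γ) (h : IsADMMSeq F G K A γ x v u) {xs : ι → ℝ}
    {vs us : κ → ℝ} (hs : IsSaddlePoint F G K A γ xs vs us) (k : ℕ) :
    (v (k + 2) - vs) ⬝ᵥ (v (k + 2) - vs) + (u (k + 2) - us) ⬝ᵥ (u (k + 2) - us)
      + ((v (k + 2) - v (k + 1)) ⬝ᵥ (v (k + 2) - v (k + 1))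
        + (u (k + 2) - u (k + 1)) ⬝ᵥ (u (k + 2) - u (k + 1)))
      ≤ (v (k + 1) - vs) ⬝ᵥ (v (k + 1) - vs) + (u (k + 1) - us) ⬝ᵥ (u (k + 1) - us) := by
  have h1 := h.left_ineq (k + 1) xs
  have h2 := hs.left_ineq (x (k + 1 + 1))
  have h3 := h.right_ineq (k + 1) vs hs.mem
  have h4 := hs.right_ineq (v (k + 1 + 1)) (h.mem (k + 1))
  have h5 := h.right_ineq (k + 1) (v (k + 1)) (h.mem k)
  have h6 := h.right_ineq k (v (k + 1 + 1)) (h.mem (k + 1))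
  have h7 : A *ᵥ x (k + 1 + 1) = u (k + 1 + 1) - u (k + 1) + v (k + 1 + 1) := by
    rw [h.dual_eq (k + 1)]; abel
  rw [Matrix.mulVec_sub, hs.mulVec_eq, h7] at h1 h2
  have e : k + 2 = k + 1 + 1 := rfl
  rw [e]
  generalize v (k + 1 + 1) = v₂ at *
  generalize v (k + 1) = v₁ at *
  generalize u (k + 1 + 1) = u₂ at *
  generalize u (k + 1) = u₁ at *
  -- the four comparisons with the saddle point, and monotonicity between consecutive steps
  have key1 : 0 ≤ (u₂ - u₁ + v₂ - v₁ + u₁) ⬝ᵥ (vs - (u₂ - u₁ + v₂))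
      + us ⬝ᵥ (u₂ - u₁ + v₂ - vs) - u₂ ⬝ᵥ (vs - v₂) - us ⬝ᵥ (v₂ - vs) :=
    nonneg_of_mul_nonneg_right (a := γ) (by linarith) hγ
  have key2 : 0 ≤ -(u₂ ⬝ᵥ (v₁ - v₂)) - u₁ ⬝ᵥ (v₂ - v₁) :=
    nonneg_of_mul_nonneg_right (a := γ) (by linarith) hγ
  simp only [add_dotProduct, dotProduct_add, sub_dotProduct, dotProduct_sub] at key1 key2 ⊢
  linarith [dotProduct_comm v₁ v₂, dotProduct_comm u₁ u₂, dotProduct_comm u₁ v₁,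
    dotProduct_comm u₁ v₂, dotProduct_comm u₂ v₁, dotProduct_comm u₂ v₂, dotProduct_comm us u₁,
    dotProduct_comm us u₂, dotProduct_comm us v₁, dotProduct_comm us v₂, dotProduct_comm vs u₁,
    dotProduct_comm vs u₂, dotProduct_comm vs v₁, dotProduct_comm vs v₂, dotProduct_comm us vs]

/-- The iterates of the two-block method converge to a saddle point, if there is one and `A` is
injective. -/
theorem IsADMMSeq.tendsto (hγ : 0 < γ) (h : IsADMMSeq F G K A γ x v u) (hF : Continuous F)
    (hG : Continuous G) (hK : IsClosed K) (hA : Function.Injective A.mulVec)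
    (hex : ∃ xs vs us, IsSaddlePoint F G K A γ xs vs us) :
    ∃ xs vs us, IsSaddlePoint F G K A γ xs vs us ∧ Tendsto x atTop (𝓝 xs) ∧
      Tendsto v atTop (𝓝 vs) := by
  -- the distance to a saddle point, as a function of the step
  let V : (κ → ℝ) → (κ → ℝ) → ℕ → ℝ := fun vs us k =>
    (v (k + 1) - vs) ⬝ᵥ (v (k + 1) - vs) + (u (k + 1) - us) ⬝ᵥ (u (k + 1) - us)
  have hV0 : ∀ vs us k, 0 ≤ V vs us k := fun vs us k =>
    add_nonneg (dotProduct_self_nonneg_real _) (dotProduct_self_nonneg_real _)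
  have hanti : ∀ {xs vs us}, IsSaddlePoint F G K A γ xs vs us → Antitone (V vs us) :=
    fun hs => antitone_nat_of_succ_le fun k => by
      have h1 := h.lyapunov hγ hs k
      have h2 := dotProduct_self_nonneg_real (v (k + 2) - v (k + 1))
      have h3 := dotProduct_self_nonneg_real (u (k + 2) - u (k + 1))
      simp only [V]
      linarith
  obtain ⟨x₀, v₀, u₀, hs₀⟩ := hex
  -- successive differences vanish
  obtain ⟨hdv, hdu⟩ : Tendsto (fun k => v (k + 2) - v (k + 1)) atTop (𝓝 0) ∧
      Tendsto (fun k => u (k + 2) - u (k + 1)) atTop (𝓝 0) := by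
    have hlim := tendsto_atTop_ciInf (hanti hs₀) ⟨0, by rintro _ ⟨k, rfl⟩; exact hV0 _ _ _⟩
    have hdiff : Tendsto (fun k => V v₀ u₀ k - V v₀ u₀ (k + 1)) atTop (𝓝 0) := by
      simpa using hlim.sub (hlim.comp (tendsto_add_atTop_nat 1))
    constructor
    · refine tendsto_of_dotProduct_self_sub (squeeze_zero
        (fun k => dotProduct_self_nonneg_real _) (fun k => ?_) hdiff)
      have h1 := h.lyapunov hγ hs₀ k
      have h3 := dotProduct_self_nonneg_real (u (k + 2) - u (k + 1))
      simp only [V, sub_zero]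
      linarith
    · refine tendsto_of_dotProduct_self_sub (squeeze_zero
        (fun k => dotProduct_self_nonneg_real _) (fun k => ?_) hdiff)
      have h1 := h.lyapunov hγ hs₀ k
      have h3 := dotProduct_self_nonneg_real (v (k + 2) - v (k + 1))
      simp only [V, sub_zero]
      linarith
  -- the pairs are bounded, so a subsequence converges
  obtain ⟨⟨vl, ul⟩, φ, hφ, hvu⟩ : ∃ l : (κ → ℝ) × (κ → ℝ), ∃ φ : ℕ → ℕ, StrictMono φ ∧
      Tendsto ((fun k => (v (k + 1), u (k + 1))) ∘ φ) atTop (𝓝 l) := by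
    set R := √(V v₀ u₀ 0)
    have hR : ∀ k, ‖v (k + 1) - v₀‖ ≤ R ∧ ‖u (k + 1) - u₀‖ ≤ R := fun k => by
      have h1 := hanti hs₀ (Nat.zero_le k)
      have h2 := sq_norm_le_dotProduct_self (v (k + 1) - v₀)
      have h3 := sq_norm_le_dotProduct_self (u (k + 1) - u₀)
      have h4 : V v₀ u₀ k = (v (k + 1) - v₀) ⬝ᵥ (v (k + 1) - v₀)
        + (u (k + 1) - u₀) ⬝ᵥ (u (k + 1) - u₀) := rfl
      constructor <;> apply Real.le_sqrt_of_sq_le <;>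
        nlinarith [sq_nonneg ‖v (k + 1) - v₀‖, sq_nonneg ‖u (k + 1) - u₀‖]
    obtain ⟨l, -, hl⟩ := tendsto_subseq_of_bounded
      (Metric.isBounded_closedBall (x := (v₀, u₀)) (r := R))
      (x := fun k => (v (k + 1), u (k + 1))) (fun k => by
        rw [mem_closedBall_iff_norm, Prod.norm_def]
        exact max_le (hR k).1 (hR k).2)
    exact ⟨l, hl⟩
  have hv1 : Tendsto (fun j => v (φ j + 1)) atTop (𝓝 vl) :=
    (continuous_fst.tendsto _).comp hvu
  have hu1 : Tendsto (fun j => u (φ j + 1)) atTop (𝓝 ul) :=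
    (continuous_snd.tendsto _).comp hvu
  have hv2 : Tendsto (fun j => v (φ j + 2)) atTop (𝓝 vl) := by
    simpa using (hdv.comp hφ.tendsto_atTop).add hv1
  have hu2 : Tendsto (fun j => u (φ j + 2)) atTop (𝓝 ul) := by
    simpa using (hdu.comp hφ.tendsto_atTop).add hu1
  -- `x` is recovered from `A x` by a left inverse of `A`
  obtain ⟨B, hB⟩ := A.mulVecLin.exists_leftInverse_of_injective (LinearMap.ker_eq_bot.2 hA)
  have hBc : Continuous B := B.continuous_of_finiteDimensional
  have hBA : ∀ z, B (A *ᵥ z) = z := fun z => LinearMap.congr_fun hB z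
  have hAc : Continuous fun z => A *ᵥ z := continuous_const.matrix_mulVec continuous_id
  have hAx : ∀ k, A *ᵥ x (k + 2) = u (k + 2) - u (k + 1) + v (k + 2) := fun k => by
    rw [h.dual_eq (k + 1)]; abel
  have hAx2 : Tendsto (fun j => A *ᵥ x (φ j + 2)) atTop (𝓝 vl) := by
    simp only [hAx]
    simpa using (hu2.sub hu1).add hv2
  have hx2 : Tendsto (fun j => x (φ j + 2)) atTop (𝓝 (B vl)) := by
    refine ((hBc.tendsto vl).comp hAx2).congr fun j => ?_
    simp [hBA]
  have hAB : A *ᵥ B vl = vl :=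
    tendsto_nhds_unique ((hAc.tendsto _).comp hx2) hAx2
  have hsad : IsSaddlePoint F G K A γ (B vl) vl ul := by
    refine ⟨hK.mem_of_tendsto hv1 (Eventually.of_forall fun j => h.mem _), hAB,
      fun x' => ?_, fun v' hv' => ?_⟩
    · have hlim : Tendsto (fun j => F x' - F (x (φ j + 2)) + γ * ((A *ᵥ x (φ j + 2)
          - v (φ j + 1) + u (φ j + 1)) ⬝ᵥ (A *ᵥ (x' - x (φ j + 2))))) atTop
          (𝓝 (F x' - F (B vl) + γ * ((vl - vl + ul) ⬝ᵥ (A *ᵥ (x' - B vl))))) := by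
        refine (tendsto_const_nhds.sub ((hF.tendsto _).comp hx2)).add (Tendsto.const_mul γ ?_)
        exact ((hAx2.sub hv1).add hu1).dotProduct_real
          ((hAc.tendsto _).comp (tendsto_const_nhds.sub hx2))
      rw [sub_self, zero_add] at hlim
      exact ge_of_tendsto' hlim fun j => h.left_ineq (φ j + 1) x'
    · have hlim : Tendsto (fun j => G v' - G (v (φ j + 1)) - γ * (u (φ j + 1) ⬝ᵥ
          (v' - v (φ j + 1)))) atTop (𝓝 (G v' - G vl - γ * (ul ⬝ᵥ (v' - vl)))) := by
        refine (tendsto_const_nhds.sub ((hG.tendsto _).comp hv1)).sub (Tendsto.const_mul γ ?_)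
        exact hu1.dotProduct_real (tendsto_const_nhds.sub hv1)
      exact ge_of_tendsto' hlim fun j => h.right_ineq (φ j) v' hv'
  -- the distance to the limit of the subsequence is monotone, hence tends to zero
  have hVl : Tendsto (V vl ul) atTop (𝓝 0) := by
    refine (tendsto_iff_tendsto_subseq_of_antitone (hanti hsad) hφ.tendsto_atTop).2 ?_
    have h1 := hv1.sub_const vl
    have h2 := hu1.sub_const ul
    simpa [V, Function.comp_def] using (h1.dotProduct_real h1).add (h2.dotProduct_real h2)
  have hv : Tendsto (fun k => v (k + 1)) atTop (𝓝 vl) :=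
    tendsto_of_dotProduct_self_sub (squeeze_zero (fun k => dotProduct_self_nonneg_real _)
      (fun k => le_add_of_nonneg_right (dotProduct_self_nonneg_real _)) hVl)
  refine ⟨B vl, vl, ul, hsad, ?_, (tendsto_add_atTop_iff_nat 1).1 hv⟩
  refine (tendsto_add_atTop_iff_nat 2).1 ?_
  have hAxl : Tendsto (fun k => A *ᵥ x (k + 2)) atTop (𝓝 vl) := by
    simp only [hAx]
    simpa using hdu.add (hv.comp (tendsto_add_atTop_nat 1))
  refine ((hBc.tendsto vl).comp hAxl).congr fun k => ?_
  simp [hBA]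

/-- Existence of a saddle point at a minimizer of `F x + G (A x)` subject to `M x ∈ S`. The
hypothesis `hqual` is the constraint qualification: the inward normals of the feasible set at the
minimizer come from those of `S`. -/
theorem exists_isSaddlePoint {μ : Type*} [Fintype μ]
    (hγ : 0 < γ) (hF : ConvexOn ℝ Set.univ F)
    (hG : ConvexOn ℝ Set.univ G) {M : Matrix μ ι ℝ} {S : Set (μ → ℝ)} (hS : Convex ℝ S)
    {x₀ : ι → ℝ} (hx₀ : M *ᵥ x₀ ∈ S)
    (hmin : ∀ x, M *ᵥ x ∈ S → F x₀ + G (A *ᵥ x₀) ≤ F x + G (A *ᵥ x))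
    (hqual : ∀ g, (∀ x, M *ᵥ x ∈ S → 0 ≤ g ⬝ᵥ (x - x₀)) →
      ∃ l, l ᵥ* M = g ∧ ∀ w ∈ S, 0 ≤ l ⬝ᵥ (w - M *ᵥ x₀)) :
    ∃ u, IsSaddlePoint F (fun v => G (v ∘ Sum.inl)) {v | v ∘ Sum.inr ∈ S}
      (Matrix.fromRows A M) γ x₀ (Matrix.fromRows A M *ᵥ x₀) u := by
  have hconv : Convex ℝ {x | M *ᵥ x ∈ S} := hS.linear_preimage M.mulVecLin
  obtain ⟨a, b, ha, hb, hab⟩ := exists_subgradients_of_min hF hG A hconv hx₀ hmin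
  obtain ⟨l, hlM, hl⟩ := hqual _ hab
  have hγ' : γ * γ⁻¹ = 1 := mul_inv_cancel₀ hγ.ne'
  refine ⟨γ⁻¹ • Sum.elim b (-l), ?_, rfl, fun x' => ?_, fun v' hv' => ?_⟩
  · rw [Matrix.fromRows_mulVec]
    exact hx₀
  · have h1 := ha x'
    have h2 : a ⬝ᵥ (x' - x₀) = l ⬝ᵥ (M *ᵥ (x' - x₀)) - b ⬝ᵥ (A *ᵥ (x' - x₀)) := by
      rw [Matrix.dotProduct_mulVec, Matrix.dotProduct_mulVec, hlM, add_dotProduct]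
      ring
    rw [smul_dotProduct, smul_eq_mul, ← mul_assoc, hγ', one_mul, Matrix.fromRows_mulVec,
      sumElim_dotProduct_sumElim, neg_dotProduct]
    linarith
  · have h1 := hb (v' ∘ Sum.inl)
    have h2 := hl _ hv'
    have h3 : v' - Matrix.fromRows A M *ᵥ x₀
        = Sum.elim (v' ∘ Sum.inl - A *ᵥ x₀) (v' ∘ Sum.inr - M *ᵥ x₀) := by
      rw [Matrix.fromRows_mulVec]
      ext (i | i) <;> simp
    rw [smul_dotProduct, smul_eq_mul, ← mul_assoc, hγ', one_mul, h3, sumElim_dotProduct_sumElim,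
      neg_dotProduct, Matrix.fromRows_mulVec, Sum.elim_comp_inl]
    linarith

end ADMM

namespace LCGQR

/-! ### The loss and the reduced problem in `β` -/

section Problem

variable {n m p q s : ℕ}

theorem sqNorm_eq_dotProduct {k : ℕ} (v : Fin k → ℝ) : sqNorm v = v ⬝ᵥ v :=
  Finset.sum_congr rfl fun i _ => pow_two (v i)

theorem checkLoss_eq_max {tau : ℝ} (t : ℝ) : checkLoss tau t = max (tau * t) ((tau - 1) * t) := by
  unfold checkLoss
  split_ifs with h
  · rw [max_eq_left (by nlinarith)]
  · rw [max_eq_right (by nlinarith)]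
    ring

theorem mul_abs_le_checkLoss (tau t : ℝ) : min tau (1 - tau) * |t| ≤ checkLoss tau t := by
  unfold checkLoss
  split_ifs with h
  · rw [abs_of_pos h]
    exact mul_le_mul_of_nonneg_right (min_le_left _ _) h.le
  · rw [abs_of_nonpos (not_lt.1 h)]
    have := mul_le_mul_of_nonneg_right (min_le_right tau (1 - tau)) (neg_nonneg.2 (not_lt.1 h))
    linarith

theorem convexOn_checkLoss (tau : ℝ) : ConvexOn ℝ Set.univ (checkLoss tau) := by
  have h1 : ∀ c : ℝ, ConvexOn ℝ Set.univ fun t : ℝ => c * t := fun c =>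
    (LinearMap.mulLeft ℝ c).convexOn convex_univ
  exact ((h1 tau).sup (h1 (tau - 1))).congr fun t _ => (checkLoss_eq_max t).symm

theorem convexOn_rho (P : LCGQR n m p q s) : ConvexOn ℝ Set.univ P.rho := by
  refine ⟨convex_univ, fun r _ r' _ a b ha hb hab => ?_⟩
  simp only [rho, smul_eq_mul, Finset.mul_sum, ← Finset.sum_add_distrib]
  exact Finset.sum_le_sum fun i _ =>
    (convexOn_checkLoss P.tau).2 (Set.mem_univ _) (Set.mem_univ _) ha hb hab

theorem mul_abs_le_rho (P : LCGQR n m p q s) (hτ₀ : 0 < P.tau) (hτ₁ : P.tau < 1)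
    (r : Fin n → ℝ) (i : Fin n) : min P.tau (1 - P.tau) * |r i| ≤ P.rho r := by
  have hmin : 0 < min P.tau (1 - P.tau) := lt_min hτ₀ (by linarith)
  refine (mul_abs_le_checkLoss P.tau (r i)).trans
    (Finset.single_le_sum (f := fun j => checkLoss P.tau (r j)) (fun j _ => ?_)
      (Finset.mem_univ i))
  exact (mul_nonneg hmin.le (abs_nonneg _)).trans (mul_abs_le_checkLoss P.tau (r j))

theorem _root_.ConvexOn.comp_sub_linearMap {E F : Type*} [AddCommGroup E] [Module ℝ E]
    [AddCommGroup F] [Module ℝ F] {f : F → ℝ} (hf : ConvexOn ℝ Set.univ f) (L : E →ₗ[ℝ] F)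
    (b : F) : ConvexOn ℝ Set.univ fun x => f (b - L x) := by
  refine ⟨convex_univ, fun x _ x' _ s t hs ht hst => ?_⟩
  have h1 : b - L (s • x + t • x') = s • (b - L x) + t • (b - L x') := by
    obtain rfl : s = 1 - t := by linarith
    rw [map_add, map_smul, map_smul]
    module
  simp only [h1]
  exact hf.2 (Set.mem_univ _) (Set.mem_univ _) hs ht hst

/-- The objective as a function of `β` alone. -/
noncomputable def cost (P : LCGQR n m p q s) (b : Fin p → ℝ) : ℝ :=
  P.rho (P.y - P.X *ᵥ b) + P.pen (P.D *ᵥ b)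

/-- `b` minimizes `ρ_τ (y - X β) + p_λ (D β)` over `C β ≥ d`, `E β = f`. -/
def IsOptimal (P : LCGQR n m p q s) (b : Fin p → ℝ) : Prop :=
  b ∈ P.feasibleSet ∧ ∀ b' ∈ P.feasibleSet, P.cost b ≤ P.cost b'

theorem linConstr_blocks (P : LCGQR n m p q s) {b : Fin p → ℝ} (hb : b ∈ P.feasibleSet) :
    P.LinConstr b (P.y - P.X *ᵥ b) (P.D *ᵥ b) (P.C *ᵥ b - P.d) :=
  ⟨rfl, rfl, sub_sub_cancel _ _, hb.2⟩

theorem objective_blocks (P : LCGQR n m p q s) {b : Fin p → ℝ} (hb : b ∈ P.feasibleSet) :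
    P.objective (P.y - P.X *ᵥ b) (P.D *ᵥ b) (P.C *ᵥ b - P.d) = (P.cost b : EReal) := by
  have : P.C *ᵥ b - P.d ∈ nonnegVec q := fun i => sub_nonneg.2 (hb.1 i)
  rw [objective, indicatorTop, if_pos this, add_zero, cost]

/-- Where the objective is finite, the linear constraints make `β` feasible. -/
theorem objective_eq_top_or (P : LCGQR n m p q s) {b : Fin p → ℝ} {r : Fin n → ℝ}
    {z : Fin m → ℝ} {w : Fin q → ℝ} (h : P.LinConstr b r z w) :
    P.objective r z w = ⊤ ∨ (b ∈ P.feasibleSet ∧ P.objective r z w = (P.cost b : EReal)) := by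
  obtain ⟨rfl, rfl, hw, hE⟩ := h
  obtain rfl : w = P.C *ᵥ b - P.d := by rw [← hw]; abel
  by_cases hn : P.C *ᵥ b - P.d ∈ nonnegVec q
  · have hb : b ∈ P.feasibleSet := ⟨fun i => sub_nonneg.1 (hn i), hE⟩
    exact Or.inr ⟨hb, P.objective_blocks hb⟩
  · left
    rw [objective, indicatorTop, if_neg hn]
    exact EReal.coe_add_top _

theorem IsOptimal.isSolution {P : LCGQR n m p q s} {b : Fin p → ℝ} (h : P.IsOptimal b) :
    P.IsSolution b (P.y - P.X *ᵥ b) (P.D *ᵥ b) (P.C *ᵥ b - P.d) := by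
  refine ⟨P.linConstr_blocks h.1, fun b' r' z' w' h' => ?_⟩
  rw [P.objective_blocks h.1]
  rcases P.objective_eq_top_or h' with h2 | ⟨hb', h2⟩
  · rw [h2]; exact le_top
  · rw [h2]; exact EReal.coe_le_coe_iff.2 (h.2 b' hb')

theorem IsSolution.isOptimal {P : LCGQR n m p q s} {b : Fin p → ℝ} {r : Fin n → ℝ}
    {z : Fin m → ℝ} {w : Fin q → ℝ} (h : P.IsSolution b r z w)
    (hfeas : P.feasibleSet.Nonempty) : P.IsOptimal b := by
  have hle : ∀ b' ∈ P.feasibleSet, P.objective r z w ≤ (P.cost b' : EReal) := fun b' hb' => by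
    rw [← P.objective_blocks hb']
    exact h.2 b' _ _ _ (P.linConstr_blocks hb')
  rcases P.objective_eq_top_or h.1 with h2 | ⟨hb, h2⟩
  · obtain ⟨b', hb'⟩ := hfeas
    have := hle b' hb'
    rw [h2, top_le_iff] at this
    exact absurd this (EReal.coe_ne_top _)
  · refine ⟨hb, fun b' hb' => ?_⟩
    have := hle b' hb'
    rw [h2] at this
    exact EReal.coe_le_coe_iff.1 this

theorem convexOn_cost (P : LCGQR n m p q s) (hconv : ConvexOn ℝ Set.univ P.pen) :
    ConvexOn ℝ Set.univ P.cost :=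
  (P.convexOn_rho.comp_sub_linearMap P.X.mulVecLin P.y).add
    (hconv.comp_linearMap P.D.mulVecLin)

/-- The constraint matrix of the feasible set written with inequalities only. -/
def ineqMatrix (P : LCGQR n m p q s) : Matrix (Fin q ⊕ (Fin s ⊕ Fin s)) (Fin p) ℝ :=
  Matrix.fromRows P.C (Matrix.fromRows P.E (-P.E))

/-- The right-hand side that goes with `ineqMatrix`. -/
def ineqRhs (P : LCGQR n m p q s) : Fin q ⊕ (Fin s ⊕ Fin s) → ℝ :=
  Sum.elim P.d (Sum.elim P.f (-P.f))

theorem mem_feasibleSet_iff (P : LCGQR n m p q s) (b : Fin p → ℝ) :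
    b ∈ P.feasibleSet ↔ P.ineqRhs ≤ P.ineqMatrix *ᵥ b := by
  rw [ineqRhs, ineqMatrix, Matrix.fromRows_mulVec, Matrix.fromRows_mulVec, Matrix.neg_mulVec]
  constructor
  · rintro ⟨h1, h2⟩ (i | i | i)
    · exact h1 i
    · exact (congrFun h2 i).ge
    · exact neg_le_neg (congrFun h2 i).le
  · intro h
    refine ⟨fun i => h (Sum.inl i), funext fun i => le_antisymm ?_ (h (Sum.inr (Sum.inl i)))⟩
    exact neg_le_neg_iff.1 (h (Sum.inr (Sum.inr i)))

theorem isClosed_feasibleSet (P : LCGQR n m p q s) : IsClosed P.feasibleSet := by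
  have : P.feasibleSet = {b | P.ineqRhs ≤ P.ineqMatrix *ᵥ b} := Set.ext P.mem_feasibleSet_iff
  rw [this]
  exact isClosed_le continuous_const (continuous_const.matrix_mulVec continuous_id)

theorem convex_feasibleSet (P : LCGQR n m p q s) : Convex ℝ P.feasibleSet := by
  have : P.feasibleSet = P.ineqMatrix.mulVecLin ⁻¹' Set.Ici P.ineqRhs :=
    Set.ext P.mem_feasibleSet_iff
  rw [this]
  exact (convex_Ici _).linear_preimage _

/-- A direction `h` in which the objective is nonincreasing satisfies `X h = 0`, as the loss grows
linearly and a symmetric convex penalty is bounded below by its value at the origin. By symmetry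
the penalty is then nonincreasing along `-D h` as well. -/
theorem cost_sub_le_of_symm (P : LCGQR n m p q s) (hτ₀ : 0 < P.tau) (hτ₁ : P.tau < 1)
    (hconv : ConvexOn ℝ Set.univ P.pen) (hsymm : ∀ z, P.pen (-z) = P.pen z) {h : Fin p → ℝ}
    (hh : ∀ t : ℝ, 0 ≤ t → ∀ x, P.cost (x + t • h) ≤ P.cost x) (x : Fin p → ℝ) :
    P.cost (x - h) ≤ P.cost x := by
  have hpen0 : ∀ z, P.pen 0 ≤ P.pen z := fun z => by
    have := hconv.2 (Set.mem_univ z) (Set.mem_univ (-z)) (show (0 : ℝ) ≤ 1 / 2 by norm_num)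
      (show (0 : ℝ) ≤ 1 / 2 by norm_num) (by norm_num)
    rw [smul_neg, add_neg_cancel, hsymm, smul_eq_mul] at this
    linarith
  have hX : P.X *ᵥ h = 0 := by
    ext i
    by_contra hne
    rw [Pi.zero_apply] at hne
    set c := min P.tau (1 - P.tau) with hc
    have hcpos : 0 < c := lt_min hτ₀ (by linarith)
    have hpos : 0 < c * |(P.X *ᵥ h) i| := mul_pos hcpos (abs_pos.2 hne)
    -- `t` is so large that the loss of the `i`-th residual at `t h` exceeds the cost at `0`
    set N := |P.cost 0 - P.pen 0| + c * |P.y i| + 1 with hN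
    have hN0 : 0 < N := by positivity
    have ht0 : 0 ≤ N / (c * |(P.X *ᵥ h) i|) := by positivity
    have h1 := hh _ ht0 0
    set t := N / (c * |(P.X *ᵥ h) i|) with ht
    have h2 : t * (c * |(P.X *ᵥ h) i|) = N := div_mul_cancel₀ _ hpos.ne'
    have h3 := P.mul_abs_le_rho hτ₀ hτ₁ (P.y - P.X *ᵥ (0 + t • h)) i
    have h4 := hpen0 (P.D *ᵥ (0 + t • h))
    have h5 : t * |(P.X *ᵥ h) i| - |P.y i| ≤ |(P.y - P.X *ᵥ (0 + t • h)) i| := by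
      rw [zero_add, Matrix.mulVec_smul, Pi.sub_apply, Pi.smul_apply, smul_eq_mul, abs_sub_comm]
      have := abs_sub_abs_le_abs_sub (t * (P.X *ᵥ h) i) (P.y i)
      rwa [abs_mul, abs_of_nonneg ht0] at this
    have h6 := mul_le_mul_of_nonneg_left h5 hcpos.le
    have h7 := le_abs_self (P.cost 0 - P.pen 0)
    rw [cost] at h1
    nlinarith
  have h1 := hh 1 zero_le_one (-x)
  have h2 : P.pen (P.D *ᵥ (x - h)) ≤ P.pen (P.D *ᵥ x) := by
    rw [one_smul, cost, cost, Matrix.mulVec_add P.X, hX, add_zero] at h1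
    have h3 : P.D *ᵥ (-x + h) = -(P.D *ᵥ (x - h)) := by
      rw [← Matrix.mulVec_neg, neg_sub, sub_eq_neg_add]
    rw [h3, Matrix.mulVec_neg _ P.D, hsymm, hsymm] at h1
    linarith
  rw [cost, cost, Matrix.mulVec_sub P.X, hX, sub_zero]
  linarith

theorem exists_isOptimal (P : LCGQR n m p q s) (hτ₀ : 0 < P.tau) (hτ₁ : P.tau < 1)
    (hconv : ConvexOn ℝ Set.univ P.pen) (hfeas : P.feasibleSet.Nonempty)
    (hpen : (∀ z, P.pen (-z) = P.pen z) ∨ ∃ b r z w, P.IsSolution b r z w) :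
    ∃ b, P.IsOptimal b := by
  rcases hpen with hsymm | ⟨b, r, z, w, h⟩
  · obtain ⟨x, hx, hmin⟩ := exists_isMinOn_polyhedron (P.convexOn_cost hconv) P.ineqMatrix
      P.ineqRhs (hfeas.imp fun b hb => (P.mem_feasibleSet_iff b).1 hb)
      fun h hh x => P.cost_sub_le_of_symm hτ₀ hτ₁ hconv hsymm hh x
    exact ⟨x, (P.mem_feasibleSet_iff x).2 hx,
      fun b' hb' => hmin b' ((P.mem_feasibleSet_iff b').1 hb')⟩
  · exact ⟨b, h.isOptimal hfeas⟩

/-! ### Convergence to an optimal point -/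

/-- If the cost splits as `F β + G (A β)` and the feasible set is `M β ∈ S`, then every run of the
two-block method for this splitting converges to an optimal point. -/
theorem _root_.IsADMMSeq.tendsto_isOptimal {P : LCGQR n m p q s} {κ μ : Type*} [Fintype κ]
    [Fintype μ] {F : (Fin p → ℝ) → ℝ} {G : (κ → ℝ) → ℝ} {A : Matrix κ (Fin p) ℝ}
    {M : Matrix μ (Fin p) ℝ} {S : Set (μ → ℝ)} {γ : ℝ} {x : ℕ → Fin p → ℝ} {v u : ℕ → κ ⊕ μ → ℝ}
    (h : IsADMMSeq F (fun v => G (v ∘ Sum.inl)) {v | v ∘ Sum.inr ∈ S} (Matrix.fromRows A M) γ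
      x v u) (hγ : 0 < γ)
    (hF : ConvexOn ℝ Set.univ F) (hG : ConvexOn ℝ Set.univ G)
    (hcost : ∀ b, F b + G (A *ᵥ b) = P.cost b)
    (hSconv : Convex ℝ S) (hSclosed : IsClosed S) (hS : ∀ b, M *ᵥ b ∈ S ↔ b ∈ P.feasibleSet)
    (hqual : ∀ x₀ ∈ P.feasibleSet, ∀ g : Fin p → ℝ,
      (∀ x ∈ P.feasibleSet, 0 ≤ g ⬝ᵥ (x - x₀)) →
      ∃ l, l ᵥ* M = g ∧ ∀ w ∈ S, 0 ≤ l ⬝ᵥ (w - M *ᵥ x₀))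
    (hinj : Function.Injective (Matrix.fromRows A M).mulVecLin) (hopt : ∃ b, P.IsOptimal b) :
    ∃ b, P.IsOptimal b ∧ Tendsto x atTop (𝓝 b) ∧
      Tendsto v atTop (𝓝 (Sum.elim (A *ᵥ b) (M *ᵥ b))) := by
  obtain ⟨b₀, hb₀, hmin⟩ := hopt
  obtain ⟨u₀, hsad⟩ := exists_isSaddlePoint (A := A) hγ hF hG hSconv ((hS b₀).2 hb₀)
    (fun x hx => by rw [hcost, hcost]; exact hmin x ((hS x).1 hx))
    (fun g hg => hqual b₀ hb₀ g fun x hx => hg x ((hS x).2 hx))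
  have hGc : Continuous fun v : κ ⊕ μ → ℝ => G (v ∘ Sum.inl) :=
    (continuous_of_convexOn_univ hG).comp (by fun_prop)
  have hKc : IsClosed {v : κ ⊕ μ → ℝ | v ∘ Sum.inr ∈ S} :=
    hSclosed.preimage (f := fun v : κ ⊕ μ → ℝ => v ∘ Sum.inr) (by fun_prop)
  obtain ⟨b, vs, us, hs, hx, hv⟩ := h.tendsto hγ (continuous_of_convexOn_univ hF) hGc hKc hinj
    ⟨_, _, _, hsad⟩
  have hK : ∀ b, Matrix.fromRows A M *ᵥ b ∈ {v : κ ⊕ μ → ℝ | v ∘ Sum.inr ∈ S} ↔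
      b ∈ P.feasibleSet := fun b => by
    rw [Matrix.fromRows_mulVec, ← hS]
    rfl
  refine ⟨b, ⟨(hK b).1 (by rw [hs.mulVec_eq]; exact hs.mem), fun b' hb' => ?_⟩, hx, ?_⟩
  · have := hs.isMin ((hK b').2 hb')
    simpa only [Matrix.fromRows_mulVec, Sum.elim_comp_inl, hcost] using this
  · rwa [← hs.mulVec_eq, Matrix.fromRows_mulVec] at hv

/-- The constraint set `v ≥ d`, `v' = f` for the pair `(C β, E β)`. -/
def constrSet (P : LCGQR n m p q s) : Set (Fin q ⊕ Fin s → ℝ) :=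
  {v | P.d ≤ v ∘ Sum.inl ∧ v ∘ Sum.inr = P.f}

theorem convex_constrSet (P : LCGQR n m p q s) : Convex ℝ P.constrSet := by
  have h : P.constrSet = LinearMap.funLeft ℝ ℝ Sum.inl ⁻¹' Set.Ici P.d
      ∩ LinearMap.funLeft ℝ ℝ Sum.inr ⁻¹' {P.f} := rfl
  rw [h]
  exact ((convex_Ici _).linear_preimage _).inter ((convex_singleton _).linear_preimage _)

theorem isClosed_constrSet (P : LCGQR n m p q s) : IsClosed P.constrSet := by
  refine IsClosed.and ?_ ?_
  · exact isClosed_le continuous_const (by fun_prop)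
  · exact isClosed_eq (by fun_prop) continuous_const

theorem mulVec_mem_constrSet_iff (P : LCGQR n m p q s) (b : Fin p → ℝ) :
    Matrix.fromRows P.C P.E *ᵥ b ∈ P.constrSet ↔ b ∈ P.feasibleSet := by
  rw [Matrix.fromRows_mulVec]
  rfl

/-- Farkas' lemma for the feasible set, with the two multipliers of each equality merged. -/
theorem exists_multiplier_constrSet (P : LCGQR n m p q s) {x₀ : Fin p → ℝ}
    (hx₀ : x₀ ∈ P.feasibleSet) {g : Fin p → ℝ}
    (hg : ∀ x ∈ P.feasibleSet, 0 ≤ g ⬝ᵥ (x - x₀)) :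
    ∃ l, l ᵥ* Matrix.fromRows P.C P.E = g ∧
      ∀ w ∈ P.constrSet, 0 ≤ l ⬝ᵥ (w - Matrix.fromRows P.C P.E *ᵥ x₀) := by
  obtain ⟨l, hl, hlg, hcomp⟩ := exists_multiplier_polyhedron P.ineqMatrix P.ineqRhs
    ((P.mem_feasibleSet_iff x₀).1 hx₀) g fun x hx => hg x ((P.mem_feasibleSet_iff x).2 hx)
  refine ⟨Sum.elim (l ∘ Sum.inl) (l ∘ Sum.inr ∘ Sum.inl - l ∘ Sum.inr ∘ Sum.inr), ?_, ?_⟩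
  · rw [← hlg, ineqMatrix, Matrix.vecMul_fromRows, Matrix.vecMul_fromRows,
      Matrix.vecMul_fromRows, Matrix.vecMul_neg, Sum.elim_comp_inl, Sum.elim_comp_inr,
      Matrix.sub_vecMul]
    simp only [Function.comp_assoc, sub_eq_add_neg]
  · rintro w ⟨hw1, hw2⟩
    have h1 : w - Matrix.fromRows P.C P.E *ᵥ x₀
        = Sum.elim (w ∘ Sum.inl - P.C *ᵥ x₀) 0 := by
      rw [Matrix.fromRows_mulVec]
      ext (i | i)
      · rfl
      · have h2 := congrFun hw2 i
        have h3 := congrFun hx₀.2 i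
        simp only [Function.comp_apply] at h2
        simp [h2, h3]
    rw [h1, sumElim_dotProduct_sumElim, dotProduct_zero, add_zero]
    refine Finset.sum_nonneg fun i _ => ?_
    have h2 := hcomp (Sum.inl i)
    have h3 : (P.ineqMatrix *ᵥ x₀) (Sum.inl i) = (P.C *ᵥ x₀) i := by
      rw [ineqMatrix, Matrix.fromRows_mulVec, Sum.elim_inl]
    rw [h3, ineqRhs, Sum.elim_inl] at h2
    have h4 := mul_nonneg (hl (Sum.inl i)) (sub_nonneg.2 (hw1 i))
    simp only [Function.comp_apply, Pi.sub_apply] at h4 ⊢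
    linarith

/-- With `β` itself as constrained variable, the constraint qualification is trivial. -/
theorem exists_multiplier_one (P : LCGQR n m p q s) {x₀ g : Fin p → ℝ}
    (hg : ∀ x ∈ P.feasibleSet, 0 ≤ g ⬝ᵥ (x - x₀)) :
    ∃ l, l ᵥ* (1 : Matrix (Fin p) (Fin p) ℝ) = g ∧
      ∀ w ∈ P.feasibleSet, 0 ≤ l ⬝ᵥ (w - (1 : Matrix (Fin p) (Fin p) ℝ) *ᵥ x₀) :=
  ⟨g, Matrix.vecMul_one g, by rwa [Matrix.one_mulVec]⟩

end Problem

/-! ### Steps of the algorithms -/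

section Steps

variable {ι κ : Type*} [Fintype ι] [Fintype κ]

/-- Existence for a step whose quadratic term `Q` agrees with the square of an injective affine
map up to summands that do not involve the block. -/
theorem exists_isMinOn_step {f : (ι → ℝ) → ℝ} (hf : ConvexOn ℝ Set.univ f) {S : Set (ι → ℝ)}
    (hS : IsClosed S) (hne : S.Nonempty) {L : (ι → ℝ) →ₗ[ℝ] (κ → ℝ)}
    (hL : Function.Injective L) {γ : ℝ} (hγ : 0 < γ) {b : κ → ℝ} {Q : (ι → ℝ) → ℝ}
    (hQ : ∀ x x', Q x - Q x' = (L x + b) ⬝ᵥ (L x + b) - (L x' + b) ⬝ᵥ (L x' + b)) :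
    ∃ x ∈ S, IsMinOn (fun x => f x + γ / 2 * Q x) S x := by
  obtain ⟨x, hx, hmin⟩ := exists_min_add_sq hf hS hne hL b hγ
  refine ⟨x, hx, isMinOn_iff.2 fun x' hx' => ?_⟩
  have h1 := isMinOn_iff.1 hmin x' hx'
  beta_reduce at h1 ⊢
  linear_combination h1 - γ / 2 * hQ x' x

/-- Optimality condition of a step whose quadratic term `Q` agrees with the square of an affine
map up to summands that do not involve the block. -/
theorem variational_ineq_step {ι κ : Type*} [Fintype κ] {f : (ι → ℝ) → ℝ} {S : Set (ι → ℝ)}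
    (hf : ConvexOn ℝ S f) {L : (ι → ℝ) →ₗ[ℝ] (κ → ℝ)} {γ : ℝ} {z : ι → ℝ} {Q : (ι → ℝ) → ℝ}
    (hz : IsMinOn (fun x => f x + γ / 2 * Q x) S z) (hzS : z ∈ S) {b : κ → ℝ}
    (hQ : ∀ x x', Q x - Q x' = (L x + b) ⬝ᵥ (L x + b) - (L x' + b) ⬝ᵥ (L x' + b))
    {x : ι → ℝ} (hx : x ∈ S) :
    0 ≤ f x - f z + γ * ((L z + b) ⬝ᵥ L (x - z)) := by
  refine IsMinOn.variational_ineq hf (isMinOn_iff.2 fun x' hx' => ?_) hzS hx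
  have h1 := isMinOn_iff.1 hz x' hx'
  beta_reduce at h1
  linear_combination h1 + γ / 2 * hQ x' z

theorem isMinOn_indicatorTop_iff {α : Type*} {S : Set α} (hS : S.Nonempty) {Q : α → ℝ} {x : α} :
    IsMinOn (fun w => indicatorTop S w + ((Q w : ℝ) : EReal)) Set.univ x ↔
      x ∈ S ∧ IsMinOn Q S x := by
  have hin : ∀ w ∈ S, indicatorTop S w + ((Q w : ℝ) : EReal) = (Q w : EReal) := fun w hw => by
    rw [indicatorTop, if_pos hw, zero_add]
  have hout : ∀ w ∉ S, indicatorTop S w + ((Q w : ℝ) : EReal) = ⊤ := fun w hw => by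
    rw [indicatorTop, if_neg hw]
    exact EReal.top_add_coe _
  constructor
  · intro h
    have hx : x ∈ S := by
      by_contra hx
      obtain ⟨w, hw⟩ := hS
      have := isMinOn_iff.1 h w (Set.mem_univ w)
      beta_reduce at this
      rw [hin w hw, hout x hx, top_le_iff] at this
      exact EReal.coe_ne_top _ this
    refine ⟨hx, isMinOn_iff.2 fun w hw => ?_⟩
    have := isMinOn_iff.1 h w (Set.mem_univ w)
    beta_reduce at this
    rw [hin w hw, hin x hx] at this
    exact EReal.coe_le_coe_iff.1 this
  · rintro ⟨hx, h⟩
    refine isMinOn_iff.2 fun w _ => ?_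
    rw [hin x hx]
    by_cases hw : w ∈ S
    · rw [hin w hw]
      exact EReal.coe_le_coe_iff.2 (isMinOn_iff.1 h w hw)
    · rw [hout w hw]
      exact le_top

theorem exists_isRun {α : Type*} {step : α → α → Prop} (h : ∀ a, ∃ a', step a a') (a₀ : α) :
    ∃ a, a 0 = a₀ ∧ IsRun step a := by
  choose f hf using h
  exact ⟨fun k => f^[k] a₀, rfl, fun k => by
    simp only [Function.iterate_succ_apply']
    exact hf _⟩

theorem convexOn_zero {ι : Type*} : ConvexOn ℝ Set.univ fun _ : ι → ℝ => (0 : ℝ) :=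
  convexOn_const 0 convex_univ

theorem isClosed_nonnegVec (q : ℕ) : IsClosed (nonnegVec q) := isClosed_Ici (a := (0 : Fin q → ℝ))

theorem convex_nonnegVec (q : ℕ) : Convex ℝ (nonnegVec q) := convex_Ici (0 : Fin q → ℝ)

theorem nonnegVec_nonempty (q : ℕ) : (nonnegVec q).Nonempty := ⟨0, fun _ => le_rfl⟩

theorem sqNorm_neg {k : ℕ} (v : Fin k → ℝ) : sqNorm (-v) = sqNorm v := by
  simp [sqNorm]

/-- Existence in a step over a block that enters the quadratic term through `‖x + c‖²`. -/
theorem exists_prox {k : ℕ} {f : (Fin k → ℝ) → ℝ} (hf : ConvexOn ℝ Set.univ f) {γ : ℝ}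
    (hγ : 0 < γ) {Q : (Fin k → ℝ) → ℝ} {c : Fin k → ℝ}
    (hQ : ∀ x x', Q x - Q x' = sqNorm (x + c) - sqNorm (x' + c)) :
    ∃ x, IsMinOn (fun x => f x + γ / 2 * Q x) Set.univ x := by
  obtain ⟨x, -, h⟩ := exists_isMinOn_step hf isClosed_univ Set.univ_nonempty
    (L := LinearMap.id) Function.injective_id hγ (b := c) (Q := Q)
    (fun x x' => by rw [hQ, sqNorm_eq_dotProduct, sqNorm_eq_dotProduct]; rfl)
  exact ⟨x, h⟩

theorem prox_ineq {k : ℕ} {f : (Fin k → ℝ) → ℝ} (hf : ConvexOn ℝ Set.univ f) {γ : ℝ}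
    {Q : (Fin k → ℝ) → ℝ} {c : Fin k → ℝ}
    (hQ : ∀ x x', Q x - Q x' = sqNorm (x + c) - sqNorm (x' + c)) {z : Fin k → ℝ}
    (hz : IsMinOn (fun x => f x + γ / 2 * Q x) Set.univ z) (x : Fin k → ℝ) :
    0 ≤ f x - f z + γ * ((z + c) ⬝ᵥ (x - z)) :=
  variational_ineq_step hf hz (Set.mem_univ z) (L := LinearMap.id) (b := c)
    (fun x x' => by rw [hQ, sqNorm_eq_dotProduct, sqNorm_eq_dotProduct]; rfl) (Set.mem_univ x)

/-- Existence in a projection step: the objective is the indicator of a closed set. -/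
theorem exists_proj {k : ℕ} {S : Set (Fin k → ℝ)} (hS : IsClosed S) (hne : S.Nonempty) {γ : ℝ}
    (hγ : 0 < γ) {Q : (Fin k → ℝ) → ℝ} {c : Fin k → ℝ}
    (hQ : ∀ x x', Q x - Q x' = sqNorm (x + c) - sqNorm (x' + c)) :
    ∃ x, IsMinOn (fun x => indicatorTop S x + ((γ / 2 * Q x : ℝ) : EReal)) Set.univ x := by
  obtain ⟨x, hx, h⟩ := exists_isMinOn_step convexOn_zero hS hne
    (L := LinearMap.id) Function.injective_id hγ (b := c) (Q := Q)
    (fun x x' => by rw [hQ, sqNorm_eq_dotProduct, sqNorm_eq_dotProduct]; rfl)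
  simp only [zero_add] at h
  exact ⟨x, (isMinOn_indicatorTop_iff hne).2 ⟨hx, h⟩⟩

theorem proj_ineq {k : ℕ} {S : Set (Fin k → ℝ)} (hS : Convex ℝ S) (hne : S.Nonempty) {γ : ℝ}
    {Q : (Fin k → ℝ) → ℝ} {c : Fin k → ℝ}
    (hQ : ∀ x x', Q x - Q x' = sqNorm (x + c) - sqNorm (x' + c)) {z : Fin k → ℝ}
    (hz : IsMinOn (fun x => indicatorTop S x + ((γ / 2 * Q x : ℝ) : EReal)) Set.univ z) :
    z ∈ S ∧ ∀ x ∈ S, 0 ≤ γ * ((z + c) ⬝ᵥ (x - z)) := by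
  obtain ⟨hzS, h⟩ := (isMinOn_indicatorTop_iff hne).1 hz
  refine ⟨hzS, fun x hx => ?_⟩
  have := variational_ineq_step (convexOn_const (0 : ℝ) hS) (γ := γ) (Q := Q)
    (by simpa only [zero_add] using h) hzS (L := LinearMap.id) (b := c)
    (fun x x' => by rw [hQ, sqNorm_eq_dotProduct, sqNorm_eq_dotProduct]; rfl) hx
  simpa using this

/-! The residuals of the constraints as functions of a single block. -/

theorem sqNorm_loss_residual {k : ℕ} (a y u r : Fin k → ℝ) :
    sqNorm (a + r - y + u) = sqNorm (r + (a - y + u)) := by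
  congr 1
  abel

theorem sqNorm_copy_residual {k : ℕ} (a u z : Fin k → ℝ) :
    sqNorm (a - z + u) = sqNorm (z + -(a + u)) := by
  rw [← sqNorm_neg]
  congr 1
  abel

theorem sqNorm_slack_residual {k : ℕ} (a d u w : Fin k → ℝ) :
    sqNorm (a - w - d + u) = sqNorm (w + -(a - d + u)) := by
  rw [← sqNorm_neg]
  congr 1
  abel

end Steps

section Algorithms

variable {n m p q s : ℕ}

/-- The `G`-part of the four-block splittings, in `v = (X β, D β)`. -/
noncomputable def lossPen (P : LCGQR n m p q s) (v : Fin n ⊕ Fin m → ℝ) : ℝ :=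
  P.rho (P.y - v ∘ Sum.inl) + P.pen (v ∘ Sum.inr)

theorem convexOn_lossPen (P : LCGQR n m p q s) (hconv : ConvexOn ℝ Set.univ P.pen) :
    ConvexOn ℝ Set.univ P.lossPen :=
  (P.convexOn_rho.comp_sub_linearMap (LinearMap.funLeft ℝ ℝ Sum.inl) P.y).add
    (hconv.comp_linearMap (LinearMap.funLeft ℝ ℝ Sum.inr))

theorem lossPen_mulVec (P : LCGQR n m p q s) (b : Fin p → ℝ) :
    P.lossPen (Matrix.fromRows P.X P.D *ᵥ b) = P.cost b := by
  rw [Matrix.fromRows_mulVec]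
  rfl

/-! ### ADMM4.Constr -/

/-- The combined second block of ADMM4.Constr, chosen so that its constraints read
`(X, D, C, E) β = v`. -/
def constr4V (P : LCGQR n m p q s) (r : Fin n → ℝ) (z : Fin m → ℝ) (w : Fin q → ℝ) :
    (Fin n ⊕ Fin m) ⊕ (Fin q ⊕ Fin s) → ℝ :=
  Sum.elim (Sum.elim (P.y - r) z) (Sum.elim (w + P.d) P.f)

/-- The quadratic term as the squared norm of `A β + (u - v)`. -/
theorem quad4Constr_eq (P : LCGQR n m p q s) (b : Fin p → ℝ) (r : Fin n → ℝ) (z : Fin m → ℝ)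
    (w : Fin q → ℝ) (u₁ : Fin n → ℝ) (u₂ : Fin m → ℝ) (u₃ : Fin q → ℝ) (u₄ : Fin s → ℝ) :
    P.quad4Constr b r z w u₁ u₂ u₃ u₄ =
      ((Matrix.fromRows (Matrix.fromRows P.X P.D) (Matrix.fromRows P.C P.E)).mulVecLin b
        + (Sum.elim (Sum.elim u₁ u₂) (Sum.elim u₃ u₄) - P.constr4V r z w)) ⬝ᵥ
      ((Matrix.fromRows (Matrix.fromRows P.X P.D) (Matrix.fromRows P.C P.E)).mulVecLin b
        + (Sum.elim (Sum.elim u₁ u₂) (Sum.elim u₃ u₄) - P.constr4V r z w)) := by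
  have h : (Matrix.fromRows (Matrix.fromRows P.X P.D) (Matrix.fromRows P.C P.E)).mulVecLin b
        + (Sum.elim (Sum.elim u₁ u₂) (Sum.elim u₃ u₄) - P.constr4V r z w)
      = Sum.elim (Sum.elim (P.X *ᵥ b + r - P.y + u₁) (P.D *ᵥ b - z + u₂))
        (Sum.elim (P.C *ᵥ b - w - P.d + u₃) (P.E *ᵥ b - P.f + u₄)) := by
    simp only [Matrix.mulVecLin_apply, Matrix.fromRows_mulVec, constr4V]
    ext ((i | i) | (i | i)) <;>
      simp only [Pi.add_apply, Pi.sub_apply, Sum.elim_inl, Sum.elim_inr] <;> ring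
  rw [h]
  simp only [sumElim_dotProduct_sumElim, quad4Constr, sqNorm_eq_dotProduct]
  ring

theorem quad4Constr_sub_r (P : LCGQR n m p q s) (b : Fin p → ℝ) (z : Fin m → ℝ) (w : Fin q → ℝ)
    (u₁ : Fin n → ℝ) (u₂ : Fin m → ℝ) (u₃ : Fin q → ℝ) (u₄ : Fin s → ℝ) (r₁ r₂ : Fin n → ℝ) :
    P.quad4Constr b r₁ z w u₁ u₂ u₃ u₄ - P.quad4Constr b r₂ z w u₁ u₂ u₃ u₄ =
      sqNorm (r₁ + (P.X *ᵥ b - P.y + u₁)) - sqNorm (r₂ + (P.X *ᵥ b - P.y + u₁)) := by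
  rw [← sqNorm_loss_residual (P.X *ᵥ b) _ _ r₁, ← sqNorm_loss_residual (P.X *ᵥ b) _ _ r₂]
  simp only [quad4Constr]
  ring

theorem quad4Constr_sub_z (P : LCGQR n m p q s) (b : Fin p → ℝ) (r : Fin n → ℝ) (w : Fin q → ℝ)
    (u₁ : Fin n → ℝ) (u₂ : Fin m → ℝ) (u₃ : Fin q → ℝ) (u₄ : Fin s → ℝ) (z₁ z₂ : Fin m → ℝ) :
    P.quad4Constr b r z₁ w u₁ u₂ u₃ u₄ - P.quad4Constr b r z₂ w u₁ u₂ u₃ u₄ =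
      sqNorm (z₁ + -(P.D *ᵥ b + u₂)) - sqNorm (z₂ + -(P.D *ᵥ b + u₂)) := by
  rw [← sqNorm_copy_residual (P.D *ᵥ b) _ z₁, ← sqNorm_copy_residual (P.D *ᵥ b) _ z₂]
  simp only [quad4Constr]
  ring

theorem quad4Constr_sub_w (P : LCGQR n m p q s) (b : Fin p → ℝ) (r : Fin n → ℝ) (z : Fin m → ℝ)
    (u₁ : Fin n → ℝ) (u₂ : Fin m → ℝ) (u₃ : Fin q → ℝ) (u₄ : Fin s → ℝ) (w₁ w₂ : Fin q → ℝ) :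
    P.quad4Constr b r z w₁ u₁ u₂ u₃ u₄ - P.quad4Constr b r z w₂ u₁ u₂ u₃ u₄ =
      sqNorm (w₁ + -(P.C *ᵥ b - P.d + u₃)) - sqNorm (w₂ + -(P.C *ᵥ b - P.d + u₃)) := by
  rw [← sqNorm_slack_residual (P.C *ᵥ b) _ _ w₁, ← sqNorm_slack_residual (P.C *ᵥ b) _ _ w₂]
  simp only [quad4Constr]
  ring

theorem constr4_injective (P : LCGQR n m p q s)
    (hunit : IsUnit (P.X.transpose * P.X + P.D.transpose * P.D + P.C.transpose * P.C
      + P.E.transpose * P.E)) :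
    Function.Injective
      (Matrix.fromRows (Matrix.fromRows P.X P.D) (Matrix.fromRows P.C P.E)).mulVecLin := by
  refine (injective_iff_map_eq_zero _).2 fun b hb => ?_
  simp only [Matrix.mulVecLin_apply, Matrix.fromRows_mulVec] at hb
  have h1 : P.X *ᵥ b = 0 := funext fun i => congrFun hb (Sum.inl (Sum.inl i))
  have h2 : P.D *ᵥ b = 0 := funext fun i => congrFun hb (Sum.inl (Sum.inr i))
  have h3 : P.C *ᵥ b = 0 := funext fun i => congrFun hb (Sum.inr (Sum.inl i))
  have h4 : P.E *ᵥ b = 0 := funext fun i => congrFun hb (Sum.inr (Sum.inr i))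
  refine Matrix.mulVec_injective_of_isUnit hunit ?_
  simp only [Matrix.add_mulVec, ← Matrix.mulVec_mulVec, h1, h2, h3, h4, Matrix.mulVec_zero,
    add_zero]

theorem exists_constr4Step (P : LCGQR n m p q s) {γ : ℝ} (hγ : 0 < γ)
    (hconv : ConvexOn ℝ Set.univ P.pen)
    (hinj : Function.Injective
      (Matrix.fromRows (Matrix.fromRows P.X P.D) (Matrix.fromRows P.C P.E)).mulVecLin)
    (a : Constr4State n m p q s) : ∃ a', P.Constr4Step γ a a' := by
  obtain ⟨b, -, hb⟩ := exists_isMinOn_step convexOn_zero isClosed_univ Set.univ_nonempty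
    hinj hγ (Q := fun b => P.quad4Constr b a.r a.z a.w a.u₁ a.u₂ a.u₃ a.u₄)
    (fun x x' => by rw [quad4Constr_eq, quad4Constr_eq])
  obtain ⟨r, hr⟩ := exists_prox P.convexOn_rho hγ
    (P.quad4Constr_sub_r b a.z a.w a.u₁ a.u₂ a.u₃ a.u₄)
  obtain ⟨z, hz⟩ := exists_prox hconv hγ (P.quad4Constr_sub_z b r a.w a.u₁ a.u₂ a.u₃ a.u₄)
  obtain ⟨w, hw⟩ := exists_proj (isClosed_nonnegVec q) (nonnegVec_nonempty q) hγ
    (P.quad4Constr_sub_w b r z a.u₁ a.u₂ a.u₃ a.u₄)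
  exact ⟨⟨b, r, z, w,
      a.u₁ + (P.X *ᵥ b + r - P.y), a.u₂ + (P.D *ᵥ b - z),
      a.u₃ + (P.C *ᵥ b - w - P.d), a.u₄ + (P.E *ᵥ b - P.f)⟩,
    by simpa only [zero_add] using hb, hr, hz, hw, rfl, rfl, rfl, rfl⟩

theorem exists_eq_constr4V (P : LCGQR n m p q s) {v : (Fin n ⊕ Fin m) ⊕ (Fin q ⊕ Fin s) → ℝ}
    (hv : v ∘ Sum.inr ∈ P.constrSet) :
    ∃ r z w, w ∈ nonnegVec q ∧ v = P.constr4V r z w := by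
  refine ⟨P.y - v ∘ Sum.inl ∘ Sum.inl, v ∘ Sum.inl ∘ Sum.inr, v ∘ Sum.inr ∘ Sum.inl - P.d,
    fun i => sub_nonneg.2 (hv.1 i), ?_⟩
  ext ((i | i) | (i | i))
  · simp [constr4V]
  · simp [constr4V]
  · simp [constr4V]
  · exact congrFun hv.2 i

theorem dotProduct_constr4V_sub (P : LCGQR n m p q s) (r r' : Fin n → ℝ) (z z' : Fin m → ℝ)
    (w w' : Fin q → ℝ) (u₁ : Fin n → ℝ) (u₂ : Fin m → ℝ) (u₃ : Fin q → ℝ) (u₄ : Fin s → ℝ) :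
    Sum.elim (Sum.elim u₁ u₂) (Sum.elim u₃ u₄) ⬝ᵥ (P.constr4V r' z' w' - P.constr4V r z w) =
      -(u₁ ⬝ᵥ (r' - r)) + u₂ ⬝ᵥ (z' - z) + u₃ ⬝ᵥ (w' - w) := by
  have h : P.constr4V r' z' w' - P.constr4V r z w =
      Sum.elim (Sum.elim (-(r' - r)) (z' - z)) (Sum.elim (w' - w) 0) := by
    ext ((i | i) | (i | i)) <;> simp [constr4V]
  rw [h]
  simp only [sumElim_dotProduct_sumElim, dotProduct_neg, dotProduct_zero, add_zero]

/-- A run of ADMM4.Constr is a run of the two-block method: the separate steps over the second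
blocks add up to one step over the combined block. -/
theorem isADMMSeq_constr4 (P : LCGQR n m p q s) {γ : ℝ}
    (hconv : ConvexOn ℝ Set.univ P.pen)
    {a : ℕ → Constr4State n m p q s} (ha : IsRun (P.Constr4Step γ) a) :
    IsADMMSeq (fun _ => 0) (fun v => P.lossPen (v ∘ Sum.inl)) {v | v ∘ Sum.inr ∈ P.constrSet}
      (Matrix.fromRows (Matrix.fromRows P.X P.D) (Matrix.fromRows P.C P.E)) γ (fun k => (a k).beta)
      (fun k => P.constr4V (a k).r (a k).z (a k).w)
      (fun k => Sum.elim (Sum.elim (a k).u₁ (a k).u₂) (Sum.elim (a k).u₃ (a k).u₄)) where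
  left_ineq k x' := by
    have h := variational_ineq_step convexOn_zero
      (γ := γ)
      (Q := fun b => P.quad4Constr b (a k).r (a k).z (a k).w (a k).u₁ (a k).u₂ (a k).u₃ (a k).u₄)
      (by simpa only [zero_add] using (ha k).beta_min) (Set.mem_univ _)
      (fun x x' => by rw [quad4Constr_eq, quad4Constr_eq]) (Set.mem_univ x')
    have e : ∀ b v u : (Fin n ⊕ Fin m) ⊕ (Fin q ⊕ Fin s) → ℝ, b - v + u = b + (u - v) :=
      fun _ _ _ => by abel
    rw [e]
    exact h
  mem k := by
    have h := (proj_ineq (convex_nonnegVec q) (nonnegVec_nonempty q)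
      (P.quad4Constr_sub_w (a (k + 1)).beta (a (k + 1)).r (a (k + 1)).z
        (a k).u₁ (a k).u₂ (a k).u₃ (a k).u₄)
      (ha k).w_min).1
    exact ⟨fun i => le_add_of_nonneg_left (h i), rfl⟩
  right_ineq k v' hv' := by
    obtain ⟨r', z', w', hw', rfl⟩ := P.exists_eq_constr4V hv'
    have h1 := prox_ineq P.convexOn_rho (P.quad4Constr_sub_r (a (k + 1)).beta (a k).z (a k).w
      (a k).u₁ (a k).u₂ (a k).u₃ (a k).u₄) (ha k).r_min r'
    have h2 := prox_ineq hconv (P.quad4Constr_sub_z (a (k + 1)).beta (a (k + 1)).r (a k).w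
      (a k).u₁ (a k).u₂ (a k).u₃ (a k).u₄) (ha k).z_min z'
    have e2 : (a (k + 1)).z + -(P.D *ᵥ (a (k + 1)).beta + (a k).u₂) = -(a (k + 1)).u₂ := by
      rw [(ha k).u₂_eq]
      abel
    have h3 := (proj_ineq (convex_nonnegVec q) (nonnegVec_nonempty q)
      (P.quad4Constr_sub_w (a (k + 1)).beta (a (k + 1)).r (a (k + 1)).z
        (a k).u₁ (a k).u₂ (a k).u₃ (a k).u₄)
      (ha k).w_min).2 w' hw'
    have e1 : (a (k + 1)).r + (P.X *ᵥ (a (k + 1)).beta - P.y + (a k).u₁) = (a (k + 1)).u₁ := by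
      rw [(ha k).u₁_eq]
      abel
    have e3 : (a (k + 1)).w + -(P.C *ᵥ (a (k + 1)).beta - P.d + (a k).u₃)
        = -(a (k + 1)).u₃ := by
      rw [(ha k).u₃_eq]
      abel
    rw [e1] at h1
    rw [e2, neg_dotProduct] at h2
    rw [e3, neg_dotProduct] at h3
    rw [dotProduct_constr4V_sub]
    simp only [lossPen, constr4V, Sum.elim_comp_inl, Sum.elim_comp_inr, sub_sub_cancel]
    linarith
  dual_eq k := by
    have h1 := (ha k).u₁_eq
    have h2 := (ha k).u₂_eq
    have h3 := (ha k).u₃_eq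
    have h4 := (ha k).u₄_eq
    simp only [Matrix.fromRows_mulVec, constr4V, h1, h2, h3, h4]
    ext ((i | i) | (i | i)) <;>
      simp only [Pi.add_apply, Pi.sub_apply, Sum.elim_inl, Sum.elim_inr] <;> ring

theorem constr4_tendsto (P : LCGQR n m p q s) {γ : ℝ} (hγ : 0 < γ)
    (hconv : ConvexOn ℝ Set.univ P.pen)
    (hinj : Function.Injective
      (Matrix.fromRows (Matrix.fromRows P.X P.D) (Matrix.fromRows P.C P.E)).mulVecLin)
    (hopt : ∃ b, P.IsOptimal b)
    {a : ℕ → Constr4State n m p q s} (ha : IsRun (P.Constr4Step γ) a) :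
    ∃ b, P.IsOptimal b ∧ Tendsto (fun k => (a k).beta) atTop (𝓝 b) ∧
      Tendsto (fun k => (a k).r) atTop (𝓝 (P.y - P.X *ᵥ b)) ∧
      Tendsto (fun k => (a k).z) atTop (𝓝 (P.D *ᵥ b)) ∧
      Tendsto (fun k => (a k).w) atTop (𝓝 (P.C *ᵥ b - P.d)) := by
  obtain ⟨b, hb, hx, hv⟩ := (P.isADMMSeq_constr4 hconv ha).tendsto_isOptimal hγ convexOn_zero
    (G := P.lossPen) (P.convexOn_lossPen hconv) (fun b => by rw [zero_add, P.lossPen_mulVec])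
    P.convex_constrSet P.isClosed_constrSet
    P.mulVec_mem_constrSet_iff (fun x₀ hx₀ g hg => P.exists_multiplier_constrSet hx₀ hg)
    hinj hopt
  rw [Matrix.fromRows_mulVec, Matrix.fromRows_mulVec] at hv
  refine ⟨b, hb, hx, ?_, ?_, ?_⟩
  · have h : Tendsto (fun k => P.y -
        fun i => P.constr4V (a k).r (a k).z (a k).w (Sum.inl (Sum.inl i))) atTop
        (𝓝 (P.y - P.X *ᵥ b)) :=
      tendsto_const_nhds.sub (tendsto_pi_nhds.2 fun i => tendsto_pi_nhds.1 hv (Sum.inl (Sum.inl i)))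
    exact h.congr fun k => sub_sub_cancel _ _
  · exact tendsto_pi_nhds.2 fun i => tendsto_pi_nhds.1 hv (Sum.inl (Sum.inr i))
  · have h : Tendsto (fun k =>
        (fun i => P.constr4V (a k).r (a k).z (a k).w (Sum.inr (Sum.inl i))) - P.d) atTop
        (𝓝 (P.C *ᵥ b - P.d)) :=
      (tendsto_pi_nhds.2 fun i => tendsto_pi_nhds.1 hv (Sum.inr (Sum.inl i))).sub_const P.d
    exact h.congr fun k => add_sub_cancel_right _ _

/-! ### ADMM4.Proj -/

/-- The combined second block of ADMM4.Proj, chosen so that its constraints read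
`(X, D, 1) β = v`. -/
def proj4V (P : LCGQR n m p q s) (r : Fin n → ℝ) (z : Fin m → ℝ) (w : Fin p → ℝ) :
    (Fin n ⊕ Fin m) ⊕ Fin p → ℝ :=
  Sum.elim (Sum.elim (P.y - r) z) w

/-- The quadratic term as the squared norm of `A β + (u - v)`. -/
theorem quad4Proj_eq (P : LCGQR n m p q s) (b : Fin p → ℝ) (r : Fin n → ℝ) (z : Fin m → ℝ)
    (w : Fin p → ℝ) (u₁ : Fin n → ℝ) (u₂ : Fin m → ℝ) (u₃ : Fin p → ℝ) :
    P.quad4Proj b r z w u₁ u₂ u₃ =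
      ((Matrix.fromRows (Matrix.fromRows P.X P.D) (1 : Matrix (Fin p) (Fin p) ℝ)).mulVecLin b
        + (Sum.elim (Sum.elim u₁ u₂) u₃ - P.proj4V r z w)) ⬝ᵥ
      ((Matrix.fromRows (Matrix.fromRows P.X P.D) (1 : Matrix (Fin p) (Fin p) ℝ)).mulVecLin b
        + (Sum.elim (Sum.elim u₁ u₂) u₃ - P.proj4V r z w)) := by
  have h : (Matrix.fromRows (Matrix.fromRows P.X P.D) (1 : Matrix (Fin p) (Fin p) ℝ)).mulVecLin b
        + (Sum.elim (Sum.elim u₁ u₂) u₃ - P.proj4V r z w)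
      = Sum.elim (Sum.elim (P.X *ᵥ b + r - P.y + u₁) (P.D *ᵥ b - z + u₂))
        (b - w + u₃) := by
    simp only [Matrix.mulVecLin_apply, Matrix.fromRows_mulVec, proj4V, Matrix.one_mulVec]
    ext ((i | i) | i) <;>
      simp only [Pi.add_apply, Pi.sub_apply, Sum.elim_inl, Sum.elim_inr] <;> ring
  rw [h]
  simp only [sumElim_dotProduct_sumElim, quad4Proj, sqNorm_eq_dotProduct]

theorem quad4Proj_sub_r (P : LCGQR n m p q s) (b : Fin p → ℝ) (z : Fin m → ℝ) (w : Fin p → ℝ)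
    (u₁ : Fin n → ℝ) (u₂ : Fin m → ℝ) (u₃ : Fin p → ℝ) (r₁ r₂ : Fin n → ℝ) :
    P.quad4Proj b r₁ z w u₁ u₂ u₃ - P.quad4Proj b r₂ z w u₁ u₂ u₃ =
      sqNorm (r₁ + (P.X *ᵥ b - P.y + u₁)) - sqNorm (r₂ + (P.X *ᵥ b - P.y + u₁)) := by
  rw [← sqNorm_loss_residual (P.X *ᵥ b) _ _ r₁, ← sqNorm_loss_residual (P.X *ᵥ b) _ _ r₂]
  simp only [quad4Proj]
  ring

theorem quad4Proj_sub_z (P : LCGQR n m p q s) (b : Fin p → ℝ) (r : Fin n → ℝ) (w : Fin p → ℝ)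
    (u₁ : Fin n → ℝ) (u₂ : Fin m → ℝ) (u₃ : Fin p → ℝ) (z₁ z₂ : Fin m → ℝ) :
    P.quad4Proj b r z₁ w u₁ u₂ u₃ - P.quad4Proj b r z₂ w u₁ u₂ u₃ =
      sqNorm (z₁ + -(P.D *ᵥ b + u₂)) - sqNorm (z₂ + -(P.D *ᵥ b + u₂)) := by
  rw [← sqNorm_copy_residual (P.D *ᵥ b) _ z₁, ← sqNorm_copy_residual (P.D *ᵥ b) _ z₂]
  simp only [quad4Proj]
  ring

theorem quad4Proj_sub_w (P : LCGQR n m p q s) (b : Fin p → ℝ) (r : Fin n → ℝ) (z : Fin m → ℝ)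
    (u₁ : Fin n → ℝ) (u₂ : Fin m → ℝ) (u₃ : Fin p → ℝ) (w₁ w₂ : Fin p → ℝ) :
    P.quad4Proj b r z w₁ u₁ u₂ u₃ - P.quad4Proj b r z w₂ u₁ u₂ u₃ =
      sqNorm (w₁ + -(b + u₃)) - sqNorm (w₂ + -(b + u₃)) := by
  rw [← sqNorm_copy_residual b _ w₁, ← sqNorm_copy_residual b _ w₂]
  simp only [quad4Proj]
  ring

theorem proj4_injective (P : LCGQR n m p q s) :
    Function.Injective
      (Matrix.fromRows (Matrix.fromRows P.X P.D) (1 : Matrix (Fin p) (Fin p) ℝ)).mulVecLin := by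
  refine (injective_iff_map_eq_zero _).2 fun b hb => ?_
  rw [Matrix.mulVecLin_apply, Matrix.fromRows_mulVec, Matrix.one_mulVec] at hb
  exact funext fun i => congrFun hb (Sum.inr i)

theorem exists_proj4Step (P : LCGQR n m p q s) {γ : ℝ} (hγ : 0 < γ)
    (hconv : ConvexOn ℝ Set.univ P.pen) (hfeas : P.feasibleSet.Nonempty)
    (a : Proj4State n m p) : ∃ a', P.Proj4Step γ a a' := by
  obtain ⟨b, -, hb⟩ := exists_isMinOn_step convexOn_zero isClosed_univ Set.univ_nonempty
    P.proj4_injective hγ (Q := fun b => P.quad4Proj b a.r a.z a.w a.u₁ a.u₂ a.u₃)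
    (fun x x' => by rw [quad4Proj_eq, quad4Proj_eq])
  obtain ⟨r, hr⟩ := exists_prox P.convexOn_rho hγ
    (P.quad4Proj_sub_r b a.z a.w a.u₁ a.u₂ a.u₃)
  obtain ⟨z, hz⟩ := exists_prox hconv hγ (P.quad4Proj_sub_z b r a.w a.u₁ a.u₂ a.u₃)
  obtain ⟨w, hw⟩ := exists_proj P.isClosed_feasibleSet hfeas hγ
    (P.quad4Proj_sub_w b r z a.u₁ a.u₂ a.u₃)
  exact ⟨⟨b, r, z, w,
      a.u₁ + (P.X *ᵥ b + r - P.y), a.u₂ + (P.D *ᵥ b - z), a.u₃ + (b - w)⟩,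
    by simpa only [zero_add] using hb, hr, hz, hw, rfl, rfl, rfl⟩

theorem exists_eq_proj4V (P : LCGQR n m p q s) {v : (Fin n ⊕ Fin m) ⊕ Fin p → ℝ}
    (hv : v ∘ Sum.inr ∈ P.feasibleSet) :
    ∃ r z w, w ∈ P.feasibleSet ∧ v = P.proj4V r z w := by
  refine ⟨P.y - v ∘ Sum.inl ∘ Sum.inl, v ∘ Sum.inl ∘ Sum.inr, v ∘ Sum.inr, hv, ?_⟩
  ext ((i | i) | i) <;> simp [proj4V]

theorem dotProduct_proj4V_sub (P : LCGQR n m p q s) (r r' : Fin n → ℝ) (z z' : Fin m → ℝ)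
    (w w' : Fin p → ℝ) (u₁ : Fin n → ℝ) (u₂ : Fin m → ℝ) (u₃ : Fin p → ℝ) :
    Sum.elim (Sum.elim u₁ u₂) u₃ ⬝ᵥ (P.proj4V r' z' w' - P.proj4V r z w) =
      -(u₁ ⬝ᵥ (r' - r)) + u₂ ⬝ᵥ (z' - z) + u₃ ⬝ᵥ (w' - w) := by
  have h : P.proj4V r' z' w' - P.proj4V r z w =
      Sum.elim (Sum.elim (-(r' - r)) (z' - z)) (w' - w) := by
    ext ((i | i) | i) <;> simp [proj4V]
  rw [h]
  simp only [sumElim_dotProduct_sumElim, dotProduct_neg]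

/-- A run of ADMM4.Proj is a run of the two-block method: the separate steps over the second
blocks add up to one step over the combined block. -/
theorem isADMMSeq_proj4 (P : LCGQR n m p q s) {γ : ℝ}
    (hconv : ConvexOn ℝ Set.univ P.pen) (hfeas : P.feasibleSet.Nonempty)
    {a : ℕ → Proj4State n m p} (ha : IsRun (P.Proj4Step γ) a) :
    IsADMMSeq (fun _ => 0) (fun v => P.lossPen (v ∘ Sum.inl)) {v | v ∘ Sum.inr ∈ P.feasibleSet}
      (Matrix.fromRows (Matrix.fromRows P.X P.D) (1 : Matrix (Fin p) (Fin p) ℝ)) γ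
      (fun k => (a k).beta)
      (fun k => P.proj4V (a k).r (a k).z (a k).w)
      (fun k => Sum.elim (Sum.elim (a k).u₁ (a k).u₂) (a k).u₃) where
  left_ineq k x' := by
    have h := variational_ineq_step convexOn_zero
      (γ := γ)
      (Q := fun b => P.quad4Proj b (a k).r (a k).z (a k).w (a k).u₁ (a k).u₂ (a k).u₃)
      (by simpa only [zero_add] using (ha k).beta_min) (Set.mem_univ _)
      (fun x x' => by rw [quad4Proj_eq, quad4Proj_eq]) (Set.mem_univ x')
    have e : ∀ b v u : (Fin n ⊕ Fin m) ⊕ Fin p → ℝ, b - v + u = b + (u - v) :=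
      fun _ _ _ => by abel
    rw [e]
    exact h
  mem k := by
    exact (proj_ineq P.convex_feasibleSet hfeas
      (P.quad4Proj_sub_w (a (k + 1)).beta (a (k + 1)).r (a (k + 1)).z (a k).u₁ (a k).u₂ (a k).u₃)
      (ha k).w_min).1
  right_ineq k v' hv' := by
    obtain ⟨r', z', w', hw', rfl⟩ := P.exists_eq_proj4V hv'
    have h1 := prox_ineq P.convexOn_rho (P.quad4Proj_sub_r (a (k + 1)).beta (a k).z (a k).w
      (a k).u₁ (a k).u₂ (a k).u₃) (ha k).r_min r'
    have h2 := prox_ineq hconv (P.quad4Proj_sub_z (a (k + 1)).beta (a (k + 1)).r (a k).w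
      (a k).u₁ (a k).u₂ (a k).u₃) (ha k).z_min z'
    have e2 : (a (k + 1)).z + -(P.D *ᵥ (a (k + 1)).beta + (a k).u₂) = -(a (k + 1)).u₂ := by
      rw [(ha k).u₂_eq]
      abel
    have h3 := (proj_ineq P.convex_feasibleSet hfeas (P.quad4Proj_sub_w (a (k + 1)).beta
      (a (k + 1)).r (a (k + 1)).z (a k).u₁ (a k).u₂ (a k).u₃)
      (ha k).w_min).2 w' hw'
    have e1 : (a (k + 1)).r + (P.X *ᵥ (a (k + 1)).beta - P.y + (a k).u₁) = (a (k + 1)).u₁ := by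
      rw [(ha k).u₁_eq]
      abel
    have e3 : (a (k + 1)).w + -((a (k + 1)).beta + (a k).u₃)
        = -(a (k + 1)).u₃ := by
      rw [(ha k).u₃_eq]
      abel
    rw [e1] at h1
    rw [e2, neg_dotProduct] at h2
    rw [e3, neg_dotProduct] at h3
    rw [dotProduct_proj4V_sub]
    simp only [lossPen, proj4V, Sum.elim_comp_inl, Sum.elim_comp_inr, sub_sub_cancel]
    linarith
  dual_eq k := by
    have h1 := (ha k).u₁_eq
    have h2 := (ha k).u₂_eq
    have h3 := (ha k).u₃_eq
    simp only [Matrix.fromRows_mulVec, proj4V, Matrix.one_mulVec, h1, h2, h3]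
    ext ((i | i) | i) <;>
      simp only [Pi.add_apply, Pi.sub_apply, Sum.elim_inl, Sum.elim_inr]
    ring

theorem proj4_tendsto (P : LCGQR n m p q s) {γ : ℝ} (hγ : 0 < γ)
    (hconv : ConvexOn ℝ Set.univ P.pen) (hfeas : P.feasibleSet.Nonempty)
    (hopt : ∃ b, P.IsOptimal b)
    {a : ℕ → Proj4State n m p} (ha : IsRun (P.Proj4Step γ) a) :
    ∃ b, P.IsOptimal b ∧ Tendsto (fun k => (a k).beta) atTop (𝓝 b) := by
  obtain ⟨b, hb, hx, -⟩ := (P.isADMMSeq_proj4 hconv hfeas ha).tendsto_isOptimal hγ convexOn_zero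
    (G := P.lossPen) (P.convexOn_lossPen hconv) (fun b => by rw [zero_add, P.lossPen_mulVec])
    P.convex_feasibleSet P.isClosed_feasibleSet
    (fun b => by rw [Matrix.one_mulVec]) (fun x₀ _ g hg => P.exists_multiplier_one hg)
    P.proj4_injective hopt
  exact ⟨b, hb, hx⟩

/-! ### ADMM3.Constr -/

/-- The combined second block of ADMM3.Constr, chosen so that its constraints read
`(X, C, E) β = v`. -/
def constr3V (P : LCGQR n m p q s) (r : Fin n → ℝ) (w : Fin q → ℝ) :
    Fin n ⊕ (Fin q ⊕ Fin s) → ℝ :=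
  Sum.elim (P.y - r) (Sum.elim (w + P.d) P.f)

/-- The quadratic term as the squared norm of `A β + (u - v)`. -/
theorem quad3Constr_eq (P : LCGQR n m p q s) (b : Fin p → ℝ) (r : Fin n → ℝ)
    (w : Fin q → ℝ) (u₁ : Fin n → ℝ) (u₂ : Fin q → ℝ) (u₃ : Fin s → ℝ) :
    P.quad3Constr b r w u₁ u₂ u₃ =
      ((Matrix.fromRows P.X (Matrix.fromRows P.C P.E)).mulVecLin b
        + (Sum.elim u₁ (Sum.elim u₂ u₃) - P.constr3V r w)) ⬝ᵥ
      ((Matrix.fromRows P.X (Matrix.fromRows P.C P.E)).mulVecLin b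
        + (Sum.elim u₁ (Sum.elim u₂ u₃) - P.constr3V r w)) := by
  have h : (Matrix.fromRows P.X (Matrix.fromRows P.C P.E)).mulVecLin b
        + (Sum.elim u₁ (Sum.elim u₂ u₃) - P.constr3V r w)
      = Sum.elim (P.X *ᵥ b + r - P.y + u₁)
        (Sum.elim (P.C *ᵥ b - w - P.d + u₂) (P.E *ᵥ b - P.f + u₃)) := by
    simp only [Matrix.mulVecLin_apply, Matrix.fromRows_mulVec, constr3V]
    ext (i | (i | i)) <;>
      simp only [Pi.add_apply, Pi.sub_apply, Sum.elim_inl, Sum.elim_inr] <;> ring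
  rw [h]
  simp only [sumElim_dotProduct_sumElim, quad3Constr, sqNorm_eq_dotProduct]
  ring

theorem quad3Constr_sub_r (P : LCGQR n m p q s) (b : Fin p → ℝ) (w : Fin q → ℝ)
    (u₁ : Fin n → ℝ) (u₂ : Fin q → ℝ) (u₃ : Fin s → ℝ) (r₁ r₂ : Fin n → ℝ) :
    P.quad3Constr b r₁ w u₁ u₂ u₃ - P.quad3Constr b r₂ w u₁ u₂ u₃ =
      sqNorm (r₁ + (P.X *ᵥ b - P.y + u₁)) - sqNorm (r₂ + (P.X *ᵥ b - P.y + u₁)) := by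
  rw [← sqNorm_loss_residual (P.X *ᵥ b) _ _ r₁, ← sqNorm_loss_residual (P.X *ᵥ b) _ _ r₂]
  simp only [quad3Constr]
  ring

theorem quad3Constr_sub_w (P : LCGQR n m p q s) (b : Fin p → ℝ) (r : Fin n → ℝ)
    (u₁ : Fin n → ℝ) (u₂ : Fin q → ℝ) (u₃ : Fin s → ℝ) (w₁ w₂ : Fin q → ℝ) :
    P.quad3Constr b r w₁ u₁ u₂ u₃ - P.quad3Constr b r w₂ u₁ u₂ u₃ =
      sqNorm (w₁ + -(P.C *ᵥ b - P.d + u₂)) - sqNorm (w₂ + -(P.C *ᵥ b - P.d + u₂)) := by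
  rw [← sqNorm_slack_residual (P.C *ᵥ b) _ _ w₁, ← sqNorm_slack_residual (P.C *ᵥ b) _ _ w₂]
  simp only [quad3Constr]
  ring

theorem constr3_injective (P : LCGQR n m p q s)
    (hunit : IsUnit (P.X.transpose * P.X + P.C.transpose * P.C + P.E.transpose * P.E)) :
    Function.Injective (Matrix.fromRows P.X (Matrix.fromRows P.C P.E)).mulVecLin := by
  refine (injective_iff_map_eq_zero _).2 fun b hb => ?_
  simp only [Matrix.mulVecLin_apply, Matrix.fromRows_mulVec] at hb
  have h1 : P.X *ᵥ b = 0 := funext fun i => congrFun hb (Sum.inl i)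
  have h3 : P.C *ᵥ b = 0 := funext fun i => congrFun hb (Sum.inr (Sum.inl i))
  have h4 : P.E *ᵥ b = 0 := funext fun i => congrFun hb (Sum.inr (Sum.inr i))
  refine Matrix.mulVec_injective_of_isUnit hunit ?_
  simp only [Matrix.add_mulVec, ← Matrix.mulVec_mulVec, h1, h3, h4, Matrix.mulVec_zero,
    add_zero]

theorem exists_constr3Step (P : LCGQR n m p q s) {γ : ℝ} (hγ : 0 < γ)
    (hconv : ConvexOn ℝ Set.univ P.pen)
    (hinj : Function.Injective (Matrix.fromRows P.X (Matrix.fromRows P.C P.E)).mulVecLin)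
    (a : Constr3State n p q s) : ∃ a', P.Constr3Step γ a a' := by
  obtain ⟨b, -, hb⟩ := exists_isMinOn_step (hconv.comp_linearMap P.D.mulVecLin)
    isClosed_univ Set.univ_nonempty
    hinj hγ (Q := fun b => P.quad3Constr b a.r a.w a.u₁ a.u₂ a.u₃)
    (fun x x' => by rw [quad3Constr_eq, quad3Constr_eq])
  obtain ⟨r, hr⟩ := exists_prox P.convexOn_rho hγ
    (P.quad3Constr_sub_r b a.w a.u₁ a.u₂ a.u₃)
  obtain ⟨w, hw⟩ := exists_proj (isClosed_nonnegVec q) (nonnegVec_nonempty q) hγ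
    (P.quad3Constr_sub_w b r a.u₁ a.u₂ a.u₃)
  exact ⟨⟨b, r, w,
      a.u₁ + (P.X *ᵥ b + r - P.y), a.u₂ + (P.C *ᵥ b - w - P.d), a.u₃ + (P.E *ᵥ b - P.f)⟩,
    hb, hr, hw, rfl, rfl, rfl⟩

theorem exists_eq_constr3V (P : LCGQR n m p q s) {v : Fin n ⊕ (Fin q ⊕ Fin s) → ℝ}
    (hv : v ∘ Sum.inr ∈ P.constrSet) :
    ∃ r w, w ∈ nonnegVec q ∧ v = P.constr3V r w := by
  refine ⟨P.y - v ∘ Sum.inl, v ∘ Sum.inr ∘ Sum.inl - P.d,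
    fun i => sub_nonneg.2 (hv.1 i), ?_⟩
  ext (i | (i | i))
  · simp [constr3V]
  · simp [constr3V]
  · exact congrFun hv.2 i

theorem dotProduct_constr3V_sub (P : LCGQR n m p q s) (r r' : Fin n → ℝ)
    (w w' : Fin q → ℝ) (u₁ : Fin n → ℝ) (u₂ : Fin q → ℝ) (u₃ : Fin s → ℝ) :
    Sum.elim u₁ (Sum.elim u₂ u₃) ⬝ᵥ (P.constr3V r' w' - P.constr3V r w) =
      -(u₁ ⬝ᵥ (r' - r)) + u₂ ⬝ᵥ (w' - w) := by
  have h : P.constr3V r' w' - P.constr3V r w =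
      Sum.elim (-(r' - r)) (Sum.elim (w' - w) 0) := by
    ext (i | (i | i)) <;> simp [constr3V]
  rw [h]
  simp only [sumElim_dotProduct_sumElim, dotProduct_neg, dotProduct_zero, add_zero]

/-- A run of ADMM3.Constr is a run of the two-block method: the separate steps over the second
blocks add up to one step over the combined block. -/
theorem isADMMSeq_constr3 (P : LCGQR n m p q s) {γ : ℝ}
    (hconv : ConvexOn ℝ Set.univ P.pen)
    {a : ℕ → Constr3State n p q s} (ha : IsRun (P.Constr3Step γ) a) :
    IsADMMSeq (fun b => P.pen (P.D *ᵥ b)) (fun v => P.rho (P.y - v ∘ Sum.inl))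
      {v | v ∘ Sum.inr ∈ P.constrSet}
      (Matrix.fromRows P.X (Matrix.fromRows P.C P.E)) γ (fun k => (a k).beta)
      (fun k => P.constr3V (a k).r (a k).w)
      (fun k => Sum.elim (a k).u₁ (Sum.elim (a k).u₂ (a k).u₃)) where
  left_ineq k x' := by
    have h := variational_ineq_step (hconv.comp_linearMap P.D.mulVecLin)
      (γ := γ)
      (Q := fun b => P.quad3Constr b (a k).r (a k).w (a k).u₁ (a k).u₂ (a k).u₃)
      ((ha k).beta_min) (Set.mem_univ _)
      (fun x x' => by rw [quad3Constr_eq, quad3Constr_eq]) (Set.mem_univ x')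
    have e : ∀ b v u : Fin n ⊕ (Fin q ⊕ Fin s) → ℝ, b - v + u = b + (u - v) :=
      fun _ _ _ => by abel
    rw [e]
    exact h
  mem k := by
    have h := (proj_ineq (convex_nonnegVec q) (nonnegVec_nonempty q)
      (P.quad3Constr_sub_w (a (k + 1)).beta (a (k + 1)).r (a k).u₁ (a k).u₂ (a k).u₃)
      (ha k).w_min).1
    exact ⟨fun i => le_add_of_nonneg_left (h i), rfl⟩
  right_ineq k v' hv' := by
    obtain ⟨r', w', hw', rfl⟩ := P.exists_eq_constr3V hv'
    have h1 := prox_ineq P.convexOn_rho (P.quad3Constr_sub_r (a (k + 1)).beta (a k).w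
      (a k).u₁ (a k).u₂ (a k).u₃) (ha k).r_min r'
    have h3 := (proj_ineq (convex_nonnegVec q) (nonnegVec_nonempty q)
      (P.quad3Constr_sub_w (a (k + 1)).beta (a (k + 1)).r (a k).u₁ (a k).u₂ (a k).u₃)
      (ha k).w_min).2 w' hw'
    have e1 : (a (k + 1)).r + (P.X *ᵥ (a (k + 1)).beta - P.y + (a k).u₁) = (a (k + 1)).u₁ := by
      rw [(ha k).u₁_eq]
      abel
    have e3 : (a (k + 1)).w + -(P.C *ᵥ (a (k + 1)).beta - P.d + (a k).u₂)
        = -(a (k + 1)).u₂ := by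
      rw [(ha k).u₂_eq]
      abel
    rw [e1] at h1
    rw [e3, neg_dotProduct] at h3
    rw [dotProduct_constr3V_sub]
    simp only [constr3V, Sum.elim_comp_inl, sub_sub_cancel]
    linarith
  dual_eq k := by
    have h1 := (ha k).u₁_eq
    have h2 := (ha k).u₂_eq
    have h3 := (ha k).u₃_eq
    simp only [Matrix.fromRows_mulVec, constr3V, h1, h2, h3]
    ext (i | (i | i)) <;>
      simp only [Pi.add_apply, Pi.sub_apply, Sum.elim_inl, Sum.elim_inr] <;> ring

theorem constr3_tendsto (P : LCGQR n m p q s) {γ : ℝ} (hγ : 0 < γ)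
    (hconv : ConvexOn ℝ Set.univ P.pen)
    (hinj : Function.Injective (Matrix.fromRows P.X (Matrix.fromRows P.C P.E)).mulVecLin)
    (hopt : ∃ b, P.IsOptimal b)
    {a : ℕ → Constr3State n p q s} (ha : IsRun (P.Constr3Step γ) a) :
    ∃ b, P.IsOptimal b ∧ Tendsto (fun k => (a k).beta) atTop (𝓝 b) := by
  obtain ⟨b, hb, hx, -⟩ := (P.isADMMSeq_constr3 hconv ha).tendsto_isOptimal hγ
    (hconv.comp_linearMap P.D.mulVecLin)
    (G := fun v => P.rho (P.y - v)) (P.convexOn_rho.comp_sub_linearMap LinearMap.id P.y)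
    (fun b => add_comm _ _)
    P.convex_constrSet P.isClosed_constrSet
    P.mulVec_mem_constrSet_iff (fun x₀ hx₀ g hg => P.exists_multiplier_constrSet hx₀ hg)
    hinj hopt
  exact ⟨b, hb, hx⟩

/-! ### ADMM3.Proj -/

/-- The combined second block of ADMM3.Proj, chosen so that its constraints read
`(X, 1) β = v`. -/
def proj3V (P : LCGQR n m p q s) (r : Fin n → ℝ) (w : Fin p → ℝ) :
    Fin n ⊕ Fin p → ℝ :=
  Sum.elim (P.y - r) w

/-- The quadratic term as the squared norm of `A β + (u - v)`. -/
theorem quad3Proj_eq (P : LCGQR n m p q s) (b : Fin p → ℝ) (r : Fin n → ℝ)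
    (w : Fin p → ℝ) (u₁ : Fin n → ℝ) (u₂ : Fin p → ℝ) :
    P.quad3Proj b r w u₁ u₂ =
      ((Matrix.fromRows P.X (1 : Matrix (Fin p) (Fin p) ℝ)).mulVecLin b
        + (Sum.elim u₁ u₂ - P.proj3V r w)) ⬝ᵥ
      ((Matrix.fromRows P.X (1 : Matrix (Fin p) (Fin p) ℝ)).mulVecLin b
        + (Sum.elim u₁ u₂ - P.proj3V r w)) := by
  have h : (Matrix.fromRows P.X (1 : Matrix (Fin p) (Fin p) ℝ)).mulVecLin b
        + (Sum.elim u₁ u₂ - P.proj3V r w)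
      = Sum.elim (P.X *ᵥ b + r - P.y + u₁)
        (b - w + u₂) := by
    simp only [Matrix.mulVecLin_apply, Matrix.fromRows_mulVec, proj3V, Matrix.one_mulVec]
    ext (i | i) <;>
      simp only [Pi.add_apply, Pi.sub_apply, Sum.elim_inl, Sum.elim_inr] <;> ring
  rw [h]
  simp only [sumElim_dotProduct_sumElim, quad3Proj, sqNorm_eq_dotProduct]

theorem quad3Proj_sub_r (P : LCGQR n m p q s) (b : Fin p → ℝ) (w : Fin p → ℝ)
    (u₁ : Fin n → ℝ) (u₂ : Fin p → ℝ) (r₁ r₂ : Fin n → ℝ) :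
    P.quad3Proj b r₁ w u₁ u₂ - P.quad3Proj b r₂ w u₁ u₂ =
      sqNorm (r₁ + (P.X *ᵥ b - P.y + u₁)) - sqNorm (r₂ + (P.X *ᵥ b - P.y + u₁)) := by
  rw [← sqNorm_loss_residual (P.X *ᵥ b) _ _ r₁, ← sqNorm_loss_residual (P.X *ᵥ b) _ _ r₂]
  simp only [quad3Proj]
  ring

theorem quad3Proj_sub_w (P : LCGQR n m p q s) (b : Fin p → ℝ) (r : Fin n → ℝ)
    (u₁ : Fin n → ℝ) (u₂ : Fin p → ℝ) (w₁ w₂ : Fin p → ℝ) :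
    P.quad3Proj b r w₁ u₁ u₂ - P.quad3Proj b r w₂ u₁ u₂ =
      sqNorm (w₁ + -(b + u₂)) - sqNorm (w₂ + -(b + u₂)) := by
  rw [← sqNorm_copy_residual b _ w₁, ← sqNorm_copy_residual b _ w₂]
  simp only [quad3Proj]
  ring

theorem proj3_injective (P : LCGQR n m p q s) :
    Function.Injective (Matrix.fromRows P.X (1 : Matrix (Fin p) (Fin p) ℝ)).mulVecLin := by
  refine (injective_iff_map_eq_zero _).2 fun b hb => ?_
  rw [Matrix.mulVecLin_apply, Matrix.fromRows_mulVec, Matrix.one_mulVec] at hb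
  exact funext fun i => congrFun hb (Sum.inr i)

theorem exists_proj3Step (P : LCGQR n m p q s) {γ : ℝ} (hγ : 0 < γ)
    (hconv : ConvexOn ℝ Set.univ P.pen) (hfeas : P.feasibleSet.Nonempty)
    (a : Proj3State n p) : ∃ a', P.Proj3Step γ a a' := by
  obtain ⟨b, -, hb⟩ := exists_isMinOn_step (hconv.comp_linearMap P.D.mulVecLin)
    isClosed_univ Set.univ_nonempty
    P.proj3_injective hγ (Q := fun b => P.quad3Proj b a.r a.w a.u₁ a.u₂)
    (fun x x' => by rw [quad3Proj_eq, quad3Proj_eq])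
  obtain ⟨r, hr⟩ := exists_prox P.convexOn_rho hγ
    (P.quad3Proj_sub_r b a.w a.u₁ a.u₂)
  obtain ⟨w, hw⟩ := exists_proj P.isClosed_feasibleSet hfeas hγ
    (P.quad3Proj_sub_w b r a.u₁ a.u₂)
  exact ⟨⟨b, r, w,
      a.u₁ + (P.X *ᵥ b + r - P.y), a.u₂ + (b - w)⟩,
    hb, hr, hw, rfl, rfl⟩

theorem exists_eq_proj3V (P : LCGQR n m p q s) {v : Fin n ⊕ Fin p → ℝ}
    (hv : v ∘ Sum.inr ∈ P.feasibleSet) :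
    ∃ r w, w ∈ P.feasibleSet ∧ v = P.proj3V r w := by
  refine ⟨P.y - v ∘ Sum.inl, v ∘ Sum.inr, hv, ?_⟩
  ext (i | i) <;> simp [proj3V]

theorem dotProduct_proj3V_sub (P : LCGQR n m p q s) (r r' : Fin n → ℝ)
    (w w' : Fin p → ℝ) (u₁ : Fin n → ℝ) (u₂ : Fin p → ℝ) :
    Sum.elim u₁ u₂ ⬝ᵥ (P.proj3V r' w' - P.proj3V r w) =
      -(u₁ ⬝ᵥ (r' - r)) + u₂ ⬝ᵥ (w' - w) := by
  have h : P.proj3V r' w' - P.proj3V r w =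
      Sum.elim (-(r' - r)) (w' - w) := by
    ext (i | i) <;> simp [proj3V]
  rw [h]
  simp only [sumElim_dotProduct_sumElim, dotProduct_neg]

/-- A run of ADMM3.Proj is a run of the two-block method: the separate steps over the second
blocks add up to one step over the combined block. -/
theorem isADMMSeq_proj3 (P : LCGQR n m p q s) {γ : ℝ}
    (hconv : ConvexOn ℝ Set.univ P.pen) (hfeas : P.feasibleSet.Nonempty)
    {a : ℕ → Proj3State n p} (ha : IsRun (P.Proj3Step γ) a) :
    IsADMMSeq (fun b => P.pen (P.D *ᵥ b)) (fun v => P.rho (P.y - v ∘ Sum.inl))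
      {v | v ∘ Sum.inr ∈ P.feasibleSet}
      (Matrix.fromRows P.X (1 : Matrix (Fin p) (Fin p) ℝ)) γ
      (fun k => (a k).beta)
      (fun k => P.proj3V (a k).r (a k).w)
      (fun k => Sum.elim (a k).u₁ (a k).u₂) where
  left_ineq k x' := by
    have h := variational_ineq_step (hconv.comp_linearMap P.D.mulVecLin)
      (γ := γ)
      (Q := fun b => P.quad3Proj b (a k).r (a k).w (a k).u₁ (a k).u₂)
      ((ha k).beta_min) (Set.mem_univ _)
      (fun x x' => by rw [quad3Proj_eq, quad3Proj_eq]) (Set.mem_univ x')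
    have e : ∀ b v u : Fin n ⊕ Fin p → ℝ, b - v + u = b + (u - v) :=
      fun _ _ _ => by abel
    rw [e]
    exact h
  mem k := by
    exact (proj_ineq P.convex_feasibleSet hfeas
      (P.quad3Proj_sub_w (a (k + 1)).beta (a (k + 1)).r (a k).u₁ (a k).u₂)
      (ha k).w_min).1
  right_ineq k v' hv' := by
    obtain ⟨r', w', hw', rfl⟩ := P.exists_eq_proj3V hv'
    have h1 := prox_ineq P.convexOn_rho (P.quad3Proj_sub_r (a (k + 1)).beta (a k).w
      (a k).u₁ (a k).u₂) (ha k).r_min r'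
    have h3 := (proj_ineq P.convex_feasibleSet hfeas (P.quad3Proj_sub_w (a (k + 1)).beta
      (a (k + 1)).r (a k).u₁ (a k).u₂) (ha k).w_min).2 w' hw'
    have e1 : (a (k + 1)).r + (P.X *ᵥ (a (k + 1)).beta - P.y + (a k).u₁) = (a (k + 1)).u₁ := by
      rw [(ha k).u₁_eq]
      abel
    have e3 : (a (k + 1)).w + -((a (k + 1)).beta + (a k).u₂)
        = -(a (k + 1)).u₂ := by
      rw [(ha k).u₂_eq]
      abel
    rw [e1] at h1
    rw [e3, neg_dotProduct] at h3
    rw [dotProduct_proj3V_sub]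
    simp only [proj3V, Sum.elim_comp_inl, sub_sub_cancel]
    linarith
  dual_eq k := by
    have h1 := (ha k).u₁_eq
    have h2 := (ha k).u₂_eq
    simp only [Matrix.fromRows_mulVec, proj3V, Matrix.one_mulVec, h1, h2]
    ext (i | i) <;>
      simp only [Pi.add_apply, Pi.sub_apply, Sum.elim_inl, Sum.elim_inr]
    ring

theorem proj3_tendsto (P : LCGQR n m p q s) {γ : ℝ} (hγ : 0 < γ)
    (hconv : ConvexOn ℝ Set.univ P.pen) (hfeas : P.feasibleSet.Nonempty)
    (hopt : ∃ b, P.IsOptimal b)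
    {a : ℕ → Proj3State n p} (ha : IsRun (P.Proj3Step γ) a) :
    ∃ b, P.IsOptimal b ∧ Tendsto (fun k => (a k).beta) atTop (𝓝 b) := by
  obtain ⟨b, hb, hx, -⟩ := (P.isADMMSeq_proj3 hconv hfeas ha).tendsto_isOptimal hγ
    (hconv.comp_linearMap P.D.mulVecLin)
    (G := fun v => P.rho (P.y - v)) (P.convexOn_rho.comp_sub_linearMap LinearMap.id P.y)
    (fun b => add_comm _ _)
    P.convex_feasibleSet P.isClosed_feasibleSet
    (fun b => by rw [Matrix.one_mulVec]) (fun x₀ _ g hg => P.exists_multiplier_one hg)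
    P.proj3_injective hopt
  exact ⟨b, hb, hx⟩

end Algorithms

end LCGQR

end

theorem theorem2 {n m p q s : ℕ} (P : LCGQR n m p q s) (γ : ℝ) (hγ : 0 < γ)
    (hτ₀ : 0 < P.tau) (hτ₁ : P.tau < 1)
    (hconv : ConvexOn ℝ Set.univ P.pen)
    (hfeas : P.feasibleSet.Nonempty)
    (hpen : (∀ z, P.pen (-z) = P.pen z) ∨ ∃ b r z w, P.IsSolution b r z w) :
    -- ADMM4.Constr
    (IsUnit (P.X.transpose * P.X + P.D.transpose * P.D + P.C.transpose * P.C
        + P.E.transpose * P.E) →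
      (∀ a₀, ∃ a, a 0 = a₀ ∧ LCGQR.IsRun (P.Constr4Step γ) a) ∧
      ∀ a, LCGQR.IsRun (P.Constr4Step γ) a →
        ∃ b r z w, P.IsSolution b r z w ∧
          Tendsto (fun k => (a k).beta) atTop (𝓝 b) ∧
          Tendsto (fun k => (a k).r) atTop (𝓝 r) ∧
          Tendsto (fun k => (a k).z) atTop (𝓝 z) ∧
          Tendsto (fun k => (a k).w) atTop (𝓝 w)) ∧
    -- ADMM4.Proj
    ((∀ a₀, ∃ a, a 0 = a₀ ∧ LCGQR.IsRun (P.Proj4Step γ) a) ∧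
      ∀ a, LCGQR.IsRun (P.Proj4Step γ) a →
        ∃ b, (∃ r z w, P.IsSolution b r z w) ∧
          Tendsto (fun k => (a k).beta) atTop (𝓝 b)) ∧
    -- ADMM3.Constr
    (IsUnit (P.X.transpose * P.X + P.C.transpose * P.C + P.E.transpose * P.E) →
      (∀ a₀, ∃ a, a 0 = a₀ ∧ LCGQR.IsRun (P.Constr3Step γ) a) ∧
      ∀ a, LCGQR.IsRun (P.Constr3Step γ) a →
        ∃ b, (∃ r z w, P.IsSolution b r z w) ∧
          Tendsto (fun k => (a k).beta) atTop (𝓝 b)) ∧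
    -- ADMM3.Proj
    ((∀ a₀, ∃ a, a 0 = a₀ ∧ LCGQR.IsRun (P.Proj3Step γ) a) ∧
      ∀ a, LCGQR.IsRun (P.Proj3Step γ) a →
        ∃ b, (∃ r z w, P.IsSolution b r z w) ∧
          Tendsto (fun k => (a k).beta) atTop (𝓝 b)) := by
  have hopt := P.exists_isOptimal hτ₀ hτ₁ hconv hfeas hpen
  refine ⟨fun hunit => ?_, ?_, fun hunit => ?_, ?_⟩
  · have hinj := P.constr4_injective hunit
    refine ⟨LCGQR.exists_isRun (P.exists_constr4Step hγ hconv hinj), fun a ha => ?_⟩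
    obtain ⟨b, hb, h⟩ := P.constr4_tendsto hγ hconv hinj hopt ha
    exact ⟨b, _, _, _, hb.isSolution, h⟩
  · refine ⟨LCGQR.exists_isRun (P.exists_proj4Step hγ hconv hfeas), fun a ha => ?_⟩
    obtain ⟨b, hb, h⟩ := P.proj4_tendsto hγ hconv hfeas hopt ha
    exact ⟨b, ⟨_, _, _, hb.isSolution⟩, h⟩
  · have hinj := P.constr3_injective hunit
    refine ⟨LCGQR.exists_isRun (P.exists_constr3Step hγ hconv hinj), fun a ha => ?_⟩
    obtain ⟨b, hb, h⟩ := P.constr3_tendsto hγ hconv hinj hopt ha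
    exact ⟨b, ⟨_, _, _, hb.isSolution⟩, h⟩
  · refine ⟨LCGQR.exists_isRun (P.exists_proj3Step hγ hconv hfeas), fun a ha => ?_⟩
    obtain ⟨b, hb, h⟩ := P.proj3_tendsto hγ hconv hfeas hopt ha
    exact ⟨b, ⟨_, _, _, hb.isSolution⟩, h⟩
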